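/- **Definitions.** Banach spaces are real and $L^p(S)=L^p(S,\mathcal S,\mu;\mathbb R)$. A *Rademacher family* is a sequence $(r_j)_{j\in\mathbb N}$ of independent random variables on a complete probability space with values in $\{-1,1\}$, each value having probability $\tfrac12$. For $q\in[1,\infty)$ the Khintchine constant $B_q\in(0,\infty)$ is the smallest positive constant such that $\|\sum_{j=1}^n r_ja_j\|_{L^q}\le B_q(\sum_{j=1}^n a_j^2)^{1/2}$ for every Rademacher family and every finite sequence $(a_j)_{j=1}^n$ of reals. For $p,q\in[1,\infty)$ the Kahane–Khintchine constant $K_{q,p}\in(0,\infty)$ is the smallest positive constant such that $\|\sum_{j=1}^n r_jx_j\|_{L^q(E)}\le K_{q,p}\|\sum_{j=1}^n r_jx_j\|_{L^p(E)}$ for every Rademacher family, every Banach space $E$, every $n\in\mathbb N$ and all $x_1,\dots,x_n\in E$. A $\sigma$-finite measure space $(S,\mathcal S,\mu)$ has the *approximation-by-averaging property* if for every $n\in\mathbb N$ there is an at most countable family $(B^n_k)_{k\in\mathcal K_n}$ of pairwise disjoint sets in $\mathcal S$ with $\mu(B^n_k)\in(0,\infty)$ such that, for every Banach space $E$, every $p\in[1,\infty)$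 and every $f\in L^p(S;E)$, the functions $f_n:=\sum_{k\in\mathcal K_n}\mathbf 1_{B^n_k}\,\mu(B^n_k)^{-1}\int_{B^n_k}f\,\mathrm d\mu$ converge to $f$ in $L^p(S;E)$ as $n\to\infty$ (the families not depending on $E$, $p$, $f$). Let $(\Omega,\mathcal A,\mathbb P)$ be a probability space. A random variable $\eta\in L^q(\Omega;L^p(S))$ has an essentially unique $\mathcal S\otimes\mathcal A$-measurable version $\widetilde\eta:S\times\Omega\to\mathbb R$ with $\eta(\omega)=\widetilde\eta(\cdot,\omega)$ in $L^p(S)$ for $\mathbb P$-almost all $\omega$. We say $\eta\in L^p(S;L^q(\Omega))$ if $s\mapsto\widetilde\eta(s,\cdot)$ belongs to that Bochner space, and denote the norm of this map by $\|\eta\|_{L^p(S;L^q(\Omega))}$. **Statement.** Let $(S,\mathcal S,\mu)$ be a $\sigma$-finite measure space with the approximation-by-averaging property. (i) Let $p,q\in[1,\infty)$, $\bar q:=\min\{q,2\}$, $M\in\{1,2,\dots\}$, and let $X_1,\dots,X_M\in L^q(\Omega;L^p(S))\cap L^p(S;L^q(\Omega))$ be independent and identically distributed $L^p(S)$-valued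 random variables. Then, for every $U\in L^p(S)$, $$\Bigl\|U-\frac1M\sum_{j=1}^M X_j\Bigr\|_{L^q(\Omega;L^p(S))}\le\|U-\mathbb E[X_1]\|_{L^p(S)}+M^{-(1-1/\bar q)}\,C_{SL,q,p}(X_1),$$ where $$C_{SL,q,p}(X_1):=\begin{cases}2K_{q,\bar q}\,B_p\,\|X_1-\mathbb E[X_1]\|_{L^q(\Omega;L^p(S))}&\text{if }q\in[1,p),\\[2pt]2B_q\,\|X_1-\mathbb E[X_1]\|_{L^p(S;L^q(\Omega))}&\text{if }q\in[p,\infty).\end{cases}$$ (ii) In particular, let $q\in(1,\infty)$ and let $(X_j)_{j\ge1}$ be a sequence of independent and identically distributed $L^1(S)$-valued random variables in $L^q(\Omega;L^1(S))\cap L^1(S;L^q(\Omega))$. Then $$\lim_{M\to\infty}\Bigl\|\mathbb E[X_1]-\frac1M\sum_{j=1}^M X_j\Bigr\|_{L^q(\Omega;L^1(S))}=0.$$ -/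

import Mathlib

open MeasureTheory ProbabilityTheory Filter Topology
open scoped ENNReal

universe u v

noncomputable section

/-- A sequence of independent random variables with values in `{-1, 1}`, both values being taken
with probability `1/2`. -/
structure IsRademacherFamily {Ω : Type} [MeasurableSpace Ω] (P : Measure Ω) (r : ℕ → Ω → ℝ) :
    Prop where
  measurable : ∀ j, Measurable (r j)
  values : ∀ j ω, r j ω = -1 ∨ r j ω = 1
  prob_neg_one : ∀ j, P {ω | r j ω = -1} = 1 / 2
  prob_one : ∀ j, P {ω | r j ω = 1} = 1 / 2
  indep : iIndepFun r P

/-- The (upper) Khintchine constant `B_q`: the smallest positive real `B` with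
`‖∑ r_j a_j‖_{L^q} ≤ B (∑ a_j²)^{1/2}` for all Rademacher families on complete probability
spaces and all finite sequences of reals. -/
def khintchineB (q : ℝ≥0∞) : ℝ :=
  sInf {B : ℝ | 0 < B ∧
    ∀ (Ω : Type) [MeasurableSpace Ω] (P : Measure Ω) [IsProbabilityMeasure P] [P.IsComplete]
      (r : ℕ → Ω → ℝ), IsRademacherFamily P r →
      ∀ (n : ℕ) (a : ℕ → ℝ),
        eLpNorm (fun ω => ∑ j ∈ Finset.range n, r j ω * a j) q P
          ≤ ENNReal.ofReal (B * Real.sqrt (∑ j ∈ Finset.range n, a j ^ 2))}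

/-- The Kahane–Khintchine constant `K_{q,p}`: the smallest positive real `K` with
`‖∑ r_j x_j‖_{L^q(E)} ≤ K ‖∑ r_j x_j‖_{L^p(E)}` for all Rademacher families on complete
probability spaces, all real Banach spaces `E` and all finite sequences in `E`. (The inequality
only involves the finite-dimensional span of the `x_j`, so the universe of `E` is immaterial.) -/
def kahaneKhintchineK (q p : ℝ≥0∞) : ℝ :=
  sInf {K : ℝ | 0 < K ∧
    ∀ (Ω : Type) [MeasurableSpace Ω] (P : Measure Ω) [IsProbabilityMeasure P] [P.IsComplete]
      (r : ℕ → Ω → ℝ), IsRademacherFamily P r →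
      ∀ (E : Type u) [NormedAddCommGroup E] [NormedSpace ℝ E] [CompleteSpace E]
        (n : ℕ) (x : ℕ → E),
        eLpNorm (fun ω => ∑ j ∈ Finset.range n, r j ω • x j) q P
          ≤ ENNReal.ofReal K * eLpNorm (fun ω => ∑ j ∈ Finset.range n, r j ω • x j) p P}

/-- The function obtained from `f` by averaging over each set `B k`, `k ∈ I`:
`∑_{k ∈ I} 1_{B k} · (1/μ(B k)) ∫_{B k} f dμ`. For pairwise disjoint `B k` at most one term is
nonzero at each point. -/
def averageOver {S : Type u} [MeasurableSpace S] (μ : Measure S)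
    {E : Type v} [NormedAddCommGroup E] [NormedSpace ℝ E]
    (I : Set ℕ) (B : ℕ → Set S) (f : S → E) (s : S) : E :=
  ∑' k : I, (B k).indicator (fun _ => ⨍ x in B k, f x ∂μ) s

/-- The approximation-by-averaging property of a measure space. The families `(B n k)_{k ∈ I n}`
are chosen before the Banach space, the exponent and the function. (Elements of `L^p(S;E)` are
a.e. separably valued, so the universe of `E` is immaterial.) -/
def ApproximationByAveraging {S : Type u} [MeasurableSpace S] (μ : Measure S) : Prop :=
  ∃ (I : ℕ → Set ℕ) (B : ℕ → ℕ → Set S),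
    (∀ n, ∀ k ∈ I n, MeasurableSet (B n k) ∧ 0 < μ (B n k) ∧ μ (B n k) < ∞) ∧
    (∀ n, (I n).PairwiseDisjoint (B n)) ∧
    ∀ (E : Type v) [NormedAddCommGroup E] [NormedSpace ℝ E] [CompleteSpace E] (p : ℝ≥0∞),
      1 ≤ p → p ≠ ∞ → ∀ f : S → E, MemLp f p μ →
        Tendsto (fun n => eLpNorm (fun s => f s - averageOver μ (I n) (B n) f s) p μ)
          atTop (𝓝 0)

section Mixed

variable {S : Type u} {Ω : Type v} [MeasurableSpace S] [MeasurableSpace Ω]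

/-- `F : S → L^q(Ω)` is the map `s ↦ η(s, ·)` belonging to the random variable
`η : Ω → L^p(S)`: there is a function `g` on `S × Ω`, measurable for the product σ-algebra, with
`η ω = g(·, ω)` in `L^p(S)` for almost all `ω` and `F s = g(s, ·)` in `L^q(Ω)` for almost all
`s`. Such an `F` is unique up to equality `μ`-almost everywhere. -/
def IsSectionMap {p q : ℝ≥0∞} [Fact (1 ≤ q)] (μ : Measure S) (P : Measure Ω)
    (η : Ω → Lp ℝ p μ) (F : S → Lp ℝ q P) : Prop :=
  AEStronglyMeasurable F μ ∧
    ∃ g : S × Ω → ℝ, Measurable g ∧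
      (∀ᵐ ω ∂P, (η ω : S → ℝ) =ᵐ[μ] fun s => g (s, ω)) ∧
      (∀ᵐ s ∂μ, (F s : Ω → ℝ) =ᵐ[P] fun ω => g (s, ω))

/-- The random variable `η : Ω → L^p(S)` belongs to `L^p(S; L^q(Ω))`. -/
def MemMixed {p : ℝ≥0∞} (q : ℝ≥0∞) [Fact (1 ≤ q)] (μ : Measure S) (P : Measure Ω)
    (η : Ω → Lp ℝ p μ) : Prop :=
  ∃ F : S → Lp ℝ q P, IsSectionMap μ P η F ∧ MemLp F p μ

/-- The norm of `η` in `L^p(S; L^q(Ω))`. All section maps of `η` agree almost everywhere, so that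
the infimum is over a single value (over nothing, with value `∞`, if there is no section map). -/
def eMixedNorm {p : ℝ≥0∞} (q : ℝ≥0∞) [Fact (1 ≤ q)] (μ : Measure S) (P : Measure Ω)
    (η : Ω → Lp ℝ p μ) : ℝ≥0∞ :=
  ⨅ (F : S → Lp ℝ q P) (_ : IsSectionMap μ P η F), eLpNorm F p μ

open Classical in
/-- The constant `C_{SL,q,p}(X)`. -/
def constSL {p : ℝ≥0∞} (q : ℝ≥0∞) [Fact (1 ≤ p)] [Fact (1 ≤ q)] (μ : Measure S) (P : Measure Ω)
    (X : Ω → Lp ℝ p μ) : ℝ :=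
  if q < p then
    2 * kahaneKhintchineK.{u} q (min q 2) * khintchineB p *
      (eLpNorm (fun ω => X ω - ∫ ω', X ω' ∂P) q P).toReal
  else
    2 * khintchineB q * (eMixedNorm q μ P (fun ω => X ω - ∫ ω', X ω' ∂P)).toReal

end Mixed

end

/-! Subtract the mean: `U - M⁻¹ ∑ X j` is `U - 𝔼 X` minus `M⁻¹` times a sum of independent centred
terms `Y j`, so everything rests on bounding the `L^q` norm of that sum by `M^(1/t)` times a norm of
one summand, `t = min q 2`. The prefactor `M⁻¹` turns this into the rate `M^(-(1 - 1/t))`, which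
tends to zero when `q > 1`.

Symmetrization replaces `∑ Y j` by the Rademacher sum `∑ r j • Y j` at the cost of a factor 2. If `q
< p`, Kahane–Khintchine lowers the exponent in the signs to `t`, monotonicity raises it to `p`, and
Fubini with the scalar Khintchine inequality shows that `L^p(S)` has type `t` with constant `B_p`.
If `p ≤ q`, Minkowski's integral inequality pulls the `L^p(S)` norm outside, and scalar Khintchine
with constant `B_q` applies at each point of `S`; there the summands enter only through the moments
of their sections, which agree for identically distributed variables.

Since `B_q` and `K_{q,p}` are infima, they are usable only once some finite constant is known to be
admissible. This comes from hypercontractivity of Rademacher sums from `L^2` to `L^(2^(m+1))` in an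
arbitrary normed space: a two-point inequality, extended to `n` signs by integrating them out one at
a time. -/

/-! ### Hypercontractivity of Rademacher sums. -/

section Rademacher

variable {Ω : Type} [MeasurableSpace Ω] {P : Measure Ω} {r : ℕ → Ω → ℝ}
  {E : Type*} [NormedAddCommGroup E] [NormedSpace ℝ E]

theorem IsRademacherFamily.measurable_comp_sum (hr : IsRademacherFamily P r) {F : E → ℝ≥0∞}
    (hF : Continuous F) (n : ℕ) (x : ℕ → E) (y : E) :
    Measurable fun ω => F (y + ∑ j ∈ Finset.range n, r j ω • x j) := by
  have hg : Continuous fun v : ℕ → ℝ => F (y + ∑ j ∈ Finset.range n, v j • x j) := by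
    fun_prop
  exact hg.measurable.comp (measurable_pi_lambda _ hr.measurable)

/-- Integrating out the last sign of a Rademacher sum. -/
theorem IsRademacherFamily.lintegral_sum_succ (hr : IsRademacherFamily P r)
    {F : E → ℝ≥0∞} (hF : Continuous F) (n : ℕ) (x : ℕ → E) (y : E) :
    ∫⁻ ω, F (y + ∑ j ∈ Finset.range (n + 1), r j ω • x j) ∂P =
      ((∫⁻ ω, F (y + x n + ∑ j ∈ Finset.range n, r j ω • x j) ∂P) +
        ∫⁻ ω, F (y - x n + ∑ j ∈ Finset.range n, r j ω • x j) ∂P) / 2 := by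
  -- The event `r n = c` is independent of the earlier signs, so its indicator factors out as 1/2.
  have key : ∀ (c : ℝ) (z : E), P {ω | r n ω = c} = 1 / 2 →
      ∫⁻ ω, ({c} : Set ℝ).indicator 1 (r n ω) *
        F (z + ∑ j ∈ Finset.range n, r j ω • x j) ∂P =
      (∫⁻ ω, F (z + ∑ j ∈ Finset.range n, r j ω • x j) ∂P) / 2 := by
    intro c z hc
    have hφ : Measurable (({c} : Set ℝ).indicator (1 : ℝ → ℝ≥0∞)) :=
      measurable_one.indicator (measurableSet_singleton c)
    have hg : Measurable fun v : (Finset.range n → ℝ) =>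
        F (z + ∑ j : Finset.range n, v j • x j) := by
      have : Continuous fun v : (Finset.range n → ℝ) =>
        F (z + ∑ j : Finset.range n, v j • x j) := by fun_prop
      exact this.measurable
    have hi := hr.indep.indepFun_finset {n} (Finset.range n) (by simp) hr.measurable
    have hφ' : Measurable fun v : (({n} : Finset ℕ) → ℝ) =>
        ({c} : Set ℝ).indicator (1 : ℝ → ℝ≥0∞) (v ⟨n, by simp⟩) :=
      hφ.comp (measurable_pi_apply _)
    have hi2 := hi.comp hφ' hg
    have e1 : (fun v : (Finset.range n → ℝ) => F (z + ∑ j : Finset.range n, v j • x j)) ∘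
        (fun a (i : Finset.range n) => r i a) =
        fun ω => F (z + ∑ j ∈ Finset.range n, r j ω • x j) := by
      funext ω
      simp only [Function.comp]
      rw [Finset.sum_coe_sort (Finset.range n) (fun j => r j ω • x j)]
    rw [e1] at hi2
    have h3 := lintegral_mul_eq_lintegral_mul_lintegral_of_indepFun
      (hφ.comp (hr.measurable n)) (hr.measurable_comp_sum hF n x z) hi2
    simp only [Pi.mul_apply, Function.comp] at h3
    rw [h3]
    have e2 : ∫⁻ ω, ({c} : Set ℝ).indicator (1 : ℝ → ℝ≥0∞) (r n ω) ∂P = 1 / 2 := by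
      exact (lintegral_indicator_one (hr.measurable n (measurableSet_singleton c))).trans hc
    rw [e2, one_div, ENNReal.div_eq_inv_mul]
  have hsplit : ∀ ω, F (y + ∑ j ∈ Finset.range (n + 1), r j ω • x j) =
      ({1} : Set ℝ).indicator 1 (r n ω) *
        F (y + x n + ∑ j ∈ Finset.range n, r j ω • x j) +
      ({-1} : Set ℝ).indicator 1 (r n ω) *
        F (y - x n + ∑ j ∈ Finset.range n, r j ω • x j) := by
    intro ω
    rw [Finset.sum_range_succ]
    rcases hr.values n ω with h | h
    · have : y - x n + ∑ j ∈ Finset.range n, r j ω • x j =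
        y + (∑ j ∈ Finset.range n, r j ω • x j + (-1 : ℝ) • x n) := by
        rw [neg_one_smul]; abel
      rw [h, this]
      have h1 : (-1 : ℝ) ∉ ({1} : Set ℝ) := by norm_num
      simp [h1]
    · have : y + x n + ∑ j ∈ Finset.range n, r j ω • x j =
        y + (∑ j ∈ Finset.range n, r j ω • x j + (1 : ℝ) • x n) := by
        rw [one_smul]; abel
      rw [h, this]
      have h1 : (1 : ℝ) ∉ ({-1} : Set ℝ) := by norm_num
      simp [h1]
  simp_rw [hsplit]
  rw [lintegral_add_left, key 1 _ (hr.prob_one n), key (-1) _ (hr.prob_neg_one n),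
    ENNReal.add_div]
  exact ((measurable_one.indicator (measurableSet_singleton _)).comp (hr.measurable n)).mul
    (hr.measurable_comp_sum hF n x _)

/-- Two-point hypercontractivity from `L^2` to `L^(2^(m+1))`. -/
theorem two_point_inequality (m : ℕ) (a b : ℝ) :
    (a + (1 / 2) ^ m * b) ^ (2 * 2 ^ m) + (a - (1 / 2) ^ m * b) ^ (2 * 2 ^ m) ≤
      2 * (a ^ 2 + b ^ 2) ^ (2 ^ m) := by
  induction m generalizing a b with
  | zero => simp; nlinarith
  | succ m ih =>
    set ρ : ℝ := (1 / 2) ^ m with hρ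
    have hρ0 : 0 < ρ := by positivity
    have hρ1 : ρ ≤ 1 := pow_le_one₀ (by norm_num) (by norm_num)
    -- Squaring `a ± (ρ/2) b` gives `(a² + (ρ/2)² b²) ± ρ (a b)`, again of two-point form with the
    -- parameter `ρ` of the previous level.
    have h := ih (a ^ 2 + (ρ / 2) ^ 2 * b ^ 2) (a * b)
    have e : 2 * 2 ^ (m + 1) = 2 * (2 * 2 ^ m) := by ring
    have e2 : 2 ^ (m + 1) = 2 * 2 ^ m := by ring
    have e1 : (1 / 2 : ℝ) ^ (m + 1) = ρ / 2 := by rw [pow_succ, ← hρ]; ring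
    rw [e, e1, pow_mul, pow_mul (a - ρ / 2 * b), e2, pow_mul (a ^ 2 + b ^ 2)]
    have h1 : (a + ρ / 2 * b) ^ 2 = a ^ 2 + (ρ / 2) ^ 2 * b ^ 2 + ρ * (a * b) := by ring
    have h2 : (a - ρ / 2 * b) ^ 2 = a ^ 2 + (ρ / 2) ^ 2 * b ^ 2 - ρ * (a * b) := by ring
    rw [h1, h2]
    refine h.trans ?_
    have hρ2 : ρ ^ 2 ≤ 1 := pow_le_one₀ hρ0.le hρ1
    gcongr
    have h3 : 0 ≤ a ^ 2 * b ^ 2 := by positivity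
    have h4 : 0 ≤ b ^ 4 := by positivity
    have h5 : ρ ^ 4 ≤ 1 := pow_le_one₀ hρ0.le hρ1
    nlinarith [mul_nonneg h3 (sub_nonneg.2 hρ2), mul_nonneg h4 (sub_nonneg.2 h5)]

/-- The vectors `z ± ρ y` are convex combinations of `z + y` and `z - y`. With `a`, `b` the half sum
and half difference of the norms of the latter, their norms are at most `a ± ρ b`, which reduces the
claim to real numbers. -/
theorem two_point_inequality_norm (m : ℕ) (z y : E) :
    ‖z + ((1 / 2 : ℝ) ^ m) • y‖ ^ (2 * 2 ^ m) + ‖z - ((1 / 2 : ℝ) ^ m) • y‖ ^ (2 * 2 ^ m) ≤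
      2 * ((‖z + y‖ ^ 2 + ‖z - y‖ ^ 2) / 2) ^ (2 ^ m) := by
  set ρ : ℝ := (1 / 2) ^ m with hρ
  have hρ0 : 0 < ρ := by positivity
  have hρ1 : ρ ≤ 1 := pow_le_one₀ (by norm_num) (by norm_num)
  set a := (‖z + y‖ + ‖z - y‖) / 2
  set b := (‖z + y‖ - ‖z - y‖) / 2
  have h := two_point_inequality m a b
  have hab : a ^ 2 + b ^ 2 = (‖z + y‖ ^ 2 + ‖z - y‖ ^ 2) / 2 := by simp only [a, b]; ring
  rw [hab] at h
  have h1 : ‖z + ρ • y‖ ≤ a + ρ * b := by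
    have e : z + ρ • y = ((1 + ρ) / 2) • (z + y) + ((1 - ρ) / 2) • (z - y) := by module
    rw [e]
    refine (norm_add_le _ _).trans (le_of_eq ?_)
    rw [norm_smul, norm_smul, Real.norm_of_nonneg (by linarith), Real.norm_of_nonneg (by linarith)]
    simp only [a, b]; ring
  have h2 : ‖z - ρ • y‖ ≤ a - ρ * b := by
    have e : z - ρ • y = ((1 - ρ) / 2) • (z + y) + ((1 + ρ) / 2) • (z - y) := by module
    rw [e]
    refine (norm_add_le _ _).trans (le_of_eq ?_)
    rw [norm_smul, norm_smul, Real.norm_of_nonneg (by linarith), Real.norm_of_nonneg (by linarith)]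
    simp only [a, b]; ring
  exact (add_le_add (pow_le_pow_left₀ (norm_nonneg _) h1 _)
    (pow_le_pow_left₀ (norm_nonneg _) h2 _)).trans h

theorem two_point_inequality_enorm (m : ℕ) (z y : E) :
    (‖z + ((1 / 2 : ℝ) ^ m) • y‖ₑ ^ (2 * 2 ^ m) +
      ‖z - ((1 / 2 : ℝ) ^ m) • y‖ₑ ^ (2 * 2 ^ m)) / 2 ≤
      ((‖z + y‖ₑ ^ 2 + ‖z - y‖ₑ ^ 2) / 2) ^ (2 ^ m) := by
  have h := ENNReal.ofReal_le_ofReal (two_point_inequality_norm m z y)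
  rw [ENNReal.ofReal_add (by positivity) (by positivity), ENNReal.ofReal_mul (by norm_num),
    ENNReal.ofReal_pow (norm_nonneg _), ENNReal.ofReal_pow (norm_nonneg _),
    ENNReal.ofReal_pow (by positivity), ENNReal.ofReal_div_of_pos (by norm_num),
    ENNReal.ofReal_add (by positivity) (by positivity), ENNReal.ofReal_pow (norm_nonneg _),
    ENNReal.ofReal_pow (norm_nonneg _)] at h
  simp only [ofReal_norm, ENNReal.ofReal_ofNat] at h
  exact ENNReal.div_le_of_le_mul' h

/-- Minkowski's inequality for the mean of two functions. -/
theorem lintegral_half_add_pow_le {α : Type*} [MeasurableSpace α] {μ : Measure α} {k : ℕ}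
    (hk : 1 ≤ k) {f g : α → ℝ≥0∞} (hf : Measurable f) (hg : Measurable g) {A B : ℝ≥0∞}
    (hA : ∫⁻ a, f a ^ k ∂μ ≤ A ^ k) (hB : ∫⁻ a, g a ^ k ∂μ ≤ B ^ k) :
    ∫⁻ a, ((f a + g a) / 2) ^ k ∂μ ≤ ((A + B) / 2) ^ k := by
  have hk0 : (k : ℝ) ≠ 0 := by positivity
  have root : ∀ {C D : ℝ≥0∞}, C ≤ D ^ k → C ^ (1 / (k : ℝ)) ≤ D := by
    intro C D h
    calc C ^ (1 / (k : ℝ)) ≤ (D ^ k) ^ (1 / (k : ℝ)) := by gcongr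
      _ = D := by rw [← ENNReal.rpow_natCast, ← ENNReal.rpow_mul, mul_one_div_cancel hk0,
          ENNReal.rpow_one]
  have h := ENNReal.lintegral_Lp_add_le (μ := μ) (p := k) hf.aemeasurable hg.aemeasurable
    (by exact_mod_cast hk)
  simp only [ENNReal.rpow_natCast, Pi.add_apply] at h
  have h2 := h.trans (add_le_add (root hA) (root hB))
  have h3 : ∫⁻ a, (f a + g a) ^ k ∂μ ≤ (A + B) ^ k := by
    rw [one_div, ENNReal.rpow_inv_le_iff (by positivity), ENNReal.rpow_natCast] at h2
    exact h2
  simp only [ENNReal.div_eq_inv_mul, mul_pow]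
  rw [lintegral_const_mul _ (by fun_prop)]
  gcongr

/-- Hypercontractivity for Rademacher sums in a normed space. -/
theorem IsRademacherFamily.lintegral_hypercontractive [IsProbabilityMeasure P]
    (hr : IsRademacherFamily P r) (m n : ℕ) (x : ℕ → E) (y : E) :
    ∫⁻ ω, ‖y + ∑ j ∈ Finset.range n, r j ω • (((1 / 2 : ℝ) ^ m) • x j)‖ₑ ^ (2 * 2 ^ m) ∂P ≤
      (∫⁻ ω, ‖y + ∑ j ∈ Finset.range n, r j ω • x j‖ₑ ^ 2 ∂P) ^ (2 ^ m) := by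
  induction n generalizing y with
  | zero => simp [pow_mul]
  | succ n ih =>
    have c1 : Continuous fun z : E => ‖z‖ₑ ^ (2 * 2 ^ m) :=
      (ENNReal.continuous_pow _).comp continuous_enorm
    have c2 : Continuous fun z : E => ‖z‖ₑ ^ 2 :=
      (ENNReal.continuous_pow _).comp continuous_enorm
    rw [hr.lintegral_sum_succ c1, hr.lintegral_sum_succ c2,
      ← lintegral_add_left (hr.measurable_comp_sum c1 n _ _), ENNReal.div_eq_inv_mul,
      ← lintegral_const_mul' _ _ (by simp)]
    -- With the earlier signs frozen, the two-point inequality handles the last sign. Minkowski in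
    -- `L^(2^m)` then splits the mean of two squared norms, and the induction hypothesis applies
    -- with base points `y + x n` and `y - x n`.
    refine le_trans (lintegral_mono fun ω => ?_) (lintegral_half_add_pow_le
      (f := fun ω => ‖y + x n + ∑ j ∈ Finset.range n, r j ω • (((1 / 2 : ℝ) ^ m) • x j)‖ₑ ^ 2)
      (g := fun ω => ‖y - x n + ∑ j ∈ Finset.range n, r j ω • (((1 / 2 : ℝ) ^ m) • x j)‖ₑ ^ 2)
      Nat.one_le_two_pow (hr.measurable_comp_sum c2 n _ _) (hr.measurable_comp_sum c2 n _ _)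
      ?_ ?_)
    · have h := two_point_inequality_enorm m
        (y + ∑ j ∈ Finset.range n, r j ω • (((1 / 2 : ℝ) ^ m) • x j)) (x n)
      rw [ENNReal.div_eq_inv_mul] at h
      simp only
      rw [add_right_comm y (x n), add_right_comm y (_ • x n), ← add_sub_right_comm,
        ← add_sub_right_comm]
      exact h
    · simp only [← pow_mul]; exact ih _
    · simp only [← pow_mul]; exact ih _

theorem IsRademacherFamily.lintegral_sq [IsProbabilityMeasure P]
    (hr : IsRademacherFamily P r) (n : ℕ) (a : ℕ → ℝ) (y : ℝ) :
    ∫⁻ ω, ‖y + ∑ j ∈ Finset.range n, r j ω • a j‖ₑ ^ 2 ∂P =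
      ENNReal.ofReal (y ^ 2 + ∑ j ∈ Finset.range n, a j ^ 2) := by
  have hsq : ∀ t : ℝ, ‖t‖ₑ ^ 2 = ENNReal.ofReal (t ^ 2) := fun t => by
    rw [Real.enorm_eq_ofReal_abs, ← ENNReal.ofReal_pow (abs_nonneg t), sq_abs]
  induction n generalizing y with
  | zero => simp [hsq]
  | succ n ih =>
    have c2 : Continuous fun z : ℝ => ‖z‖ₑ ^ 2 :=
      (ENNReal.continuous_pow _).comp continuous_enorm
    have hs : 0 ≤ ∑ j ∈ Finset.range n, a j ^ 2 := Finset.sum_nonneg fun _ _ => sq_nonneg _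
    rw [hr.lintegral_sum_succ c2, ih, ih, ← ENNReal.ofReal_add (by positivity) (by positivity),
      Finset.sum_range_succ]
    have : (2 : ℝ≥0∞) = ENNReal.ofReal 2 := by simp
    rw [this, ← ENNReal.ofReal_div_of_pos (by norm_num)]
    congr 1
    ring

end Rademacher

/-! ### The optimal Khintchine and Kahane–Khintchine constants, and existence of signs. -/

section KhintchineConstants

variable {Ω : Type} [MeasurableSpace Ω] {P : Measure Ω} {r : ℕ → Ω → ℝ}
  {E : Type u} [NormedAddCommGroup E] [NormedSpace ℝ E]

theorem IsRademacherFamily.stronglyMeasurable_sum (hr : IsRademacherFamily P r) (n : ℕ)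
    (x : ℕ → E) : StronglyMeasurable fun ω => ∑ j ∈ Finset.range n, r j ω • x j :=
  Finset.stronglyMeasurable_fun_sum _ fun j _ =>
    (hr.measurable j).stronglyMeasurable.smul_const (x j)

theorem IsRademacherFamily.memLp_sum [IsProbabilityMeasure P] (hr : IsRademacherFamily P r)
    (n : ℕ) (x : ℕ → E) (p : ℝ≥0∞) : MemLp (fun ω => ∑ j ∈ Finset.range n, r j ω • x j) p P := by
  refine MemLp.of_bound (hr.stronglyMeasurable_sum n x).aestronglyMeasurable
    (∑ j ∈ Finset.range n, ‖x j‖) (ae_of_all _ fun ω => ?_)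
  refine (norm_sum_le _ _).trans (Finset.sum_le_sum fun j _ => ?_)
  rcases hr.values j ω with h | h <;> simp [h]

/-- Hypercontractivity bounds the sum with coefficients `2^(-m) • x j`; homogeneity turns the
contraction factor into the constant `2^m`. -/
theorem IsRademacherFamily.eLpNorm_sum_two_pow_le [IsProbabilityMeasure P]
    (hr : IsRademacherFamily P r) (m n : ℕ) (x : ℕ → E) :
    eLpNorm (fun ω => ∑ j ∈ Finset.range n, r j ω • x j) ((2 * 2 ^ m : ℕ) : ℝ≥0∞) P ≤
      ENNReal.ofReal (2 ^ m) * eLpNorm (fun ω => ∑ j ∈ Finset.range n, r j ω • x j) 2 P := by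
  set ρ : ℝ := (1 / 2) ^ m with hρ
  have hN : (0 : ℝ) < ((2 * 2 ^ m : ℕ) : ℝ) := by positivity
  have hN0 : ((2 * 2 ^ m : ℕ) : ℝ≥0∞) ≠ 0 := by simp
  have key : eLpNorm (fun ω => ∑ j ∈ Finset.range n, r j ω • (ρ • x j))
      ((2 * 2 ^ m : ℕ) : ℝ≥0∞) P ≤ eLpNorm (fun ω => ∑ j ∈ Finset.range n, r j ω • x j) 2 P := by
    have h := hr.lintegral_hypercontractive m n x 0
    simp only [zero_add] at h
    rw [eLpNorm_eq_lintegral_rpow_enorm_toReal hN0 (ENNReal.natCast_ne_top _),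
      ENNReal.toReal_natCast, one_div, ENNReal.rpow_inv_le_iff hN,
      eLpNorm_eq_lintegral_rpow_enorm_toReal two_ne_zero ENNReal.ofNat_ne_top, ← ENNReal.rpow_mul]
    have e : 1 / (2 : ℝ≥0∞).toReal * ((2 * 2 ^ m : ℕ) : ℝ) = ((2 ^ m : ℕ) : ℝ) := by
      push_cast
      simp
    rw [e, ENNReal.rpow_natCast]
    simpa only [ENNReal.rpow_natCast, ENNReal.toReal_ofNat, ENNReal.rpow_ofNat] using h
  have e : (fun ω => ∑ j ∈ Finset.range n, r j ω • x j) =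
      (2 ^ m : ℝ) • fun ω => ∑ j ∈ Finset.range n, r j ω • (ρ • x j) := by
    funext ω
    simp only [Pi.smul_apply, Finset.smul_sum]
    refine Finset.sum_congr rfl fun j _ => ?_
    rw [smul_comm, smul_smul (2 ^ m : ℝ) ρ, hρ, ← mul_pow]
    norm_num
  conv_lhs => rw [e]
  rw [eLpNorm_const_smul, Real.enorm_eq_ofReal (by positivity)]
  gcongr

theorem exists_le_two_mul_two_pow {q : ℝ≥0∞} (hq : q ≠ ∞) :
    ∃ m : ℕ, q ≤ ((2 * 2 ^ m : ℕ) : ℝ≥0∞) := by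
  obtain ⟨m, hm⟩ := ENNReal.exists_nat_gt hq
  refine ⟨m, hm.le.trans ?_⟩
  have : m < 2 ^ m := Nat.lt_two_pow_self
  exact_mod_cast (by omega : m ≤ 2 * 2 ^ m)

/-- An inequality valid for each admissible constant passes to the limit along a sequence tending to
the infimum. Nonemptiness is essential because `sInf ∅ = 0`. -/
theorem le_ofReal_sInf_mul {s : Set ℝ} (hs : s.Nonempty) (hpos : ∀ K ∈ s, 0 < K) {a c : ℝ≥0∞}
    (hc : c ≠ ∞) (h : ∀ K ∈ s, a ≤ ENNReal.ofReal K * c) : a ≤ ENNReal.ofReal (sInf s) * c := by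
  obtain ⟨k, -, hk, hks⟩ := exists_seq_tendsto_sInf hs ⟨0, fun K hK => (hpos K hK).le⟩
  exact ge_of_tendsto' (ENNReal.Tendsto.mul_const (ENNReal.tendsto_ofReal hk) (Or.inr hc))
    fun n => h _ (hks n)

/-- **Khintchine's inequality** with the optimal constant. -/
theorem IsRademacherFamily.eLpNorm_le_khintchineB [IsProbabilityMeasure P] [P.IsComplete]
    (hr : IsRademacherFamily P r) {q : ℝ≥0∞} (hq : q ≠ ∞) (n : ℕ) (a : ℕ → ℝ) :
    eLpNorm (fun ω => ∑ j ∈ Finset.range n, r j ω * a j) q P ≤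
      ENNReal.ofReal (khintchineB q) * ENNReal.ofReal (√(∑ j ∈ Finset.range n, a j ^ 2)) := by
  refine le_ofReal_sInf_mul ?_ (fun K hK => hK.1) ENNReal.ofReal_ne_top fun K hK => ?_
  · obtain ⟨m, hm⟩ := exists_le_two_mul_two_pow hq
    refine ⟨2 ^ m, by positivity, fun Ω _ P _ _ r hr n a => ?_⟩
    have h2 : eLpNorm (fun ω => ∑ j ∈ Finset.range n, r j ω • a j) 2 P =
        ENNReal.ofReal (√(∑ j ∈ Finset.range n, a j ^ 2)) := by
      have h := hr.lintegral_sq n a 0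
      simp only [zero_add, ne_eq, OfNat.ofNat_ne_zero, not_false_eq_true, zero_pow] at h
      rw [eLpNorm_eq_lintegral_rpow_enorm_toReal two_ne_zero ENNReal.ofNat_ne_top]
      simp only [ENNReal.toReal_ofNat, ENNReal.rpow_ofNat]
      rw [h, ENNReal.ofReal_rpow_of_nonneg (Finset.sum_nonneg fun _ _ => sq_nonneg _)
        (by norm_num), Real.sqrt_eq_rpow]
    calc eLpNorm (fun ω => ∑ j ∈ Finset.range n, r j ω * a j) q P
        ≤ eLpNorm (fun ω => ∑ j ∈ Finset.range n, r j ω • a j) ((2 * 2 ^ m : ℕ) : ℝ≥0∞) P :=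
          eLpNorm_le_eLpNorm_of_exponent_le hm (hr.stronglyMeasurable_sum n a).aestronglyMeasurable
      _ ≤ _ := hr.eLpNorm_sum_two_pow_le m n a
      _ = _ := by rw [h2, ENNReal.ofReal_mul (by positivity)]
  · rw [← ENNReal.ofReal_mul hK.1.le]
    exact hK.2 Ω P r hr n a

/-- The **Kahane–Khintchine inequality** with the optimal constant. -/
theorem IsRademacherFamily.eLpNorm_le_kahaneKhintchineK [CompleteSpace E] [IsProbabilityMeasure P]
    [P.IsComplete] (hr : IsRademacherFamily P r) {q : ℝ≥0∞} (hq : q ≠ ∞) (n : ℕ) (x : ℕ → E) :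
    eLpNorm (fun ω => ∑ j ∈ Finset.range n, r j ω • x j) q P ≤
      ENNReal.ofReal (kahaneKhintchineK.{u} q (min q 2)) *
        eLpNorm (fun ω => ∑ j ∈ Finset.range n, r j ω • x j) (min q 2) P := by
  refine le_ofReal_sInf_mul ?_ (fun K hK => hK.1) (hr.memLp_sum n x _).eLpNorm_ne_top
    fun K hK => hK.2 Ω P r hr E n x
  rcases le_total q 2 with h2 | h2
  -- For `q ≤ 2` both exponents are `q`, so 1 is admissible.
  · refine ⟨1, one_pos, fun Ω _ P _ _ r hr E _ _ _ n x => ?_⟩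
    rw [min_eq_left h2]
    simp
  · obtain ⟨m, hm⟩ := exists_le_two_mul_two_pow hq
    refine ⟨2 ^ m, by positivity, fun Ω _ P _ _ r hr E _ _ _ n x => ?_⟩
    rw [min_eq_right h2]
    exact (eLpNorm_le_eLpNorm_of_exponent_le hm
      (hr.stronglyMeasurable_sum n x).aestronglyMeasurable).trans (hr.eLpNorm_sum_two_pow_le m n x)

theorem khintchineB_nonneg (q : ℝ≥0∞) : 0 ≤ khintchineB q :=
  Real.sInf_nonneg fun _ h => h.1.le

theorem kahaneKhintchineK_nonneg (q p : ℝ≥0∞) : 0 ≤ kahaneKhintchineK.{u} q p :=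
  Real.sInf_nonneg fun _ h => h.1.le

theorem exists_isRademacherFamily :
    ∃ (R : Type) (_ : MeasurableSpace R) (Q : Measure R) (_ : IsProbabilityMeasure Q)
      (_ : Q.IsComplete) (r : ℕ → R → ℝ), IsRademacherFamily Q r := by
  let ν : Measure Bool := (2⁻¹ : ℝ≥0∞) • (Measure.dirac true + Measure.dirac false)
  have hν : IsProbabilityMeasure ν := ⟨by simp [ν, ENNReal.inv_two_add_inv_two]⟩
  let Q : Measure (ℕ → Bool) := Measure.infinitePi fun _ => ν
  let sgn : Bool → ℝ := fun b => if b then 1 else -1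
  have hsgn : Measurable sgn := measurable_of_countable _
  have hm : ∀ j : ℕ, Measurable fun ω : ℕ → Bool => sgn (ω j) :=
    fun j => hsgn.comp (measurable_pi_apply j)
  have hprob : ∀ (j : ℕ) (b : Bool), Q {ω | sgn (ω j) = sgn b} = 1 / 2 := by
    intro j b
    have e : {ω : ℕ → Bool | sgn (ω j) = sgn b} =
        (({j} : Finset ℕ) : Set ℕ).pi fun _ => {b} := by
      ext ω
      cases b <;> cases h : ω j <;> simp [sgn, h] <;> norm_num
    rw [e, Measure.infinitePi_pi _ fun _ _ => measurableSet_singleton b]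
    cases b <;> simp [ν]
  -- Coin tossing on the product space, completed. Completion leaves the measure of every set
  -- unchanged, so probabilities and independence carry over.
  refine ⟨NullMeasurableSpace (ℕ → Bool) Q, inferInstance, Q.completion,
    ⟨(Measure.completion_apply Q _).trans measure_univ⟩, inferInstance, fun j ω => sgn (ω j),
    fun j => ?_, fun j ω => ?_, fun j => ?_, fun j => ?_, ?_⟩
  · exact fun s hs => (hm j hs).nullMeasurableSet
  · cases ω j <;> simp [sgn]
  · exact (Measure.completion_apply Q _).trans (hprob j false)
  · exact (Measure.completion_apply Q _).trans (hprob j true)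
  · have h := iIndepFun_infinitePi (P := fun _ : ℕ => ν) (X := fun _ => sgn) fun _ => hsgn
    rw [iIndepFun_iff_measure_inter_preimage_eq_mul] at h ⊢
    exact h

end KhintchineConstants

/-! ### Symmetrization with fixed signs. -/

section Symmetrization

variable {Ω : Type*} [MeasurableSpace Ω] {P : Measure Ω} [IsProbabilityMeasure P]
  {E : Type*} [NormedAddCommGroup E] [NormedSpace ℝ E] [CompleteSpace E] [MeasurableSpace E]
  [BorelSpace E] {ι : Type*} [Fintype ι]

/-- Dropping independent centred summands does not increase the `L^q` norm. -/
theorem eLpNorm_sum_subset_le_of_iIndepFun_of_stronglyMeasurable {Y : ι → Ω → E}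
    (hm : ∀ j, StronglyMeasurable (Y j)) (hY : ∀ j, Integrable (Y j) P)
    (h0 : ∀ j, ∫ ω, Y j ω ∂P = 0) (hind : iIndepFun Y P) (ε : ι → ℝ) (A : Finset ι) {q : ℝ≥0∞}
    (hq : 1 ≤ q) :
    eLpNorm (fun ω => ∑ j ∈ A, ε j • Y j ω) q P ≤ eLpNorm (fun ω => ∑ j, ε j • Y j ω) q P := by
  classical
  let m : ι → MeasurableSpace Ω := fun j => MeasurableSpace.comap (Y j) inferInstance
  have hmle : ∀ j, m j ≤ _ := fun j => (hm j).measurable.comap_le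
  have hsm : ∀ j, StronglyMeasurable[m j] (Y j) := fun j =>
    (stronglyMeasurable_iff_measurable_separable (m := m j)).2
      ⟨comap_measurable _, (hm j).isSeparable_range⟩
  let mA : MeasurableSpace Ω := ⨆ j ∈ (A : Set ι), m j
  have hmA : mA ≤ _ := iSup₂_le fun j _ => hmle j
  -- Conditioning on the variables indexed by `A` keeps those terms and kills the others, which are
  -- independent of them and centred. Conditional expectation contracts the `L^q` norm.
  have hcond : P[(fun ω => ∑ j, ε j • Y j ω) | mA] =ᵐ[P] fun ω => ∑ j ∈ A, ε j • Y j ω := by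
    have e : (fun ω => ∑ j, ε j • Y j ω) =
        (fun ω => ∑ j ∈ A, ε j • Y j ω) + ∑ j ∈ Aᶜ, ε j • Y j := by
      funext ω
      simp [Finset.sum_add_sum_compl]
    have i1 : Integrable (fun ω => ∑ j ∈ A, ε j • Y j ω) P :=
      integrable_finsetSum _ fun j _ => (hY j).smul (ε j)
    have i2 : Integrable (∑ j ∈ Aᶜ, ε j • Y j) P :=
      integrable_finsetSum' _ fun j _ => (hY j).smul (ε j)
    rw [e]
    refine (condExp_add i1 i2 mA).trans ?_
    have s1 : StronglyMeasurable[mA] fun ω => ∑ j ∈ A, ε j • Y j ω :=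
      Finset.stronglyMeasurable_fun_sum _ fun j hj =>
        ((hsm j).mono (le_iSup₂_of_le j hj le_rfl)).const_smul (ε j)
    rw [condExp_of_stronglyMeasurable hmA s1 i1]
    have z : P[∑ j ∈ Aᶜ, ε j • Y j | mA] =ᵐ[P] 0 := by
      refine (condExp_finsetSum (fun j _ => (hY j).smul (ε j)) mA).trans ?_
      have hz : ∀ j ∈ Aᶜ, P[ε j • Y j | mA] =ᵐ[P] 0 := by
        intro j hj
        have hdis : Disjoint ({j} : Set ι) (A : Set ι) := by simpa using hj
        have hi := indep_iSup_of_disjoint hmle hind hdis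
        simp only [Set.mem_singleton_iff, iSup_iSup_eq_left] at hi
        have hc := condExp_indep_eq (hmle j) hmA (hsm j) hi
        filter_upwards [condExp_smul (μ := P) (ε j) (Y j) mA, hc] with ω h1 h2
        rw [h1, Pi.smul_apply, h2, h0 j, smul_zero, Pi.zero_apply]
      have hall : ∀ᵐ ω ∂P, ∀ j ∈ Aᶜ, P[ε j • Y j | mA] ω = 0 :=
        (ae_ball_iff (Finset.countable_toSet Aᶜ)).2 hz
      filter_upwards [hall] with ω hω
      rw [Finset.sum_apply]
      exact Finset.sum_eq_zero hω
    filter_upwards [z] with ω hω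
    rw [Pi.add_apply, hω, Pi.zero_apply, add_zero]
  rw [← eLpNorm_congr_ae hcond]
  exact eLpNorm_condExp_le_eLpNorm _ hq

/-- Strongly measurable versions have separable range, as the conditioning argument needs;
independence survives almost sure modification. -/
theorem eLpNorm_sum_subset_le_of_iIndepFun {Y : ι → Ω → E} (hY : ∀ j, Integrable (Y j) P)
    (h0 : ∀ j, ∫ ω, Y j ω ∂P = 0) (hind : iIndepFun Y P) (ε : ι → ℝ) (A : Finset ι) {q : ℝ≥0∞}
    (hq : 1 ≤ q) :
    eLpNorm (fun ω => ∑ j ∈ A, ε j • Y j ω) q P ≤ eLpNorm (fun ω => ∑ j, ε j • Y j ω) q P := by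
  let Z : ι → Ω → E := fun j => (hY j).1.mk (Y j)
  have hZ : ∀ j, Y j =ᵐ[P] Z j := fun j => (hY j).1.ae_eq_mk
  have hall : ∀ᵐ ω ∂P, ∀ j, Y j ω = Z j ω := ae_all_iff.2 hZ
  have e : ∀ B : Finset ι, eLpNorm (fun ω => ∑ j ∈ B, ε j • Y j ω) q P =
      eLpNorm (fun ω => ∑ j ∈ B, ε j • Z j ω) q P := fun B =>
    eLpNorm_congr_ae (by filter_upwards [hall] with ω hω; simp only [hω])
  rw [e, e]
  exact eLpNorm_sum_subset_le_of_iIndepFun_of_stronglyMeasurable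
    (fun j => (hY j).1.stronglyMeasurable_mk) (fun j => (hY j).congr (hZ j))
    (fun j => (integral_congr_ae (hZ j)).symm.trans (h0 j)) (hind.congr hZ) ε A hq

/-- Symmetrization with a fixed choice of signs. -/
theorem eLpNorm_sum_le_two_mul_eLpNorm_sum_smul {Y : ι → Ω → E} (hY : ∀ j, Integrable (Y j) P)
    (h0 : ∀ j, ∫ ω, Y j ω ∂P = 0) (hind : iIndepFun Y P) {ε : ι → ℝ}
    (hε : ∀ j, ε j = -1 ∨ ε j = 1) {q : ℝ≥0∞} (hq : 1 ≤ q) :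
    eLpNorm (fun ω => ∑ j, Y j ω) q P ≤ 2 * eLpNorm (fun ω => ∑ j, ε j • Y j ω) q P := by
  classical
  let A : Finset ι := {j | ε j = 1}
  -- The plain sum is the signed sum over the positive indices minus the signed sum over the
  -- negative ones. Each is bounded by the full signed sum, hence the factor 2.
  have e : (fun ω => ∑ j, Y j ω) =
      (fun ω => ∑ j ∈ A, ε j • Y j ω) - fun ω => ∑ j ∈ Aᶜ, ε j • Y j ω := by
    funext ω
    rw [Pi.sub_apply, ← Finset.sum_add_sum_compl A, sub_eq_add_neg, ← Finset.sum_neg_distrib]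
    congr 1
    · refine Finset.sum_congr rfl fun j hj => ?_
      have : ε j = 1 := by simpa [A] using hj
      rw [this, one_smul]
    · refine Finset.sum_congr rfl fun j hj => ?_
      have h1 : ε j ≠ 1 := by simpa [A] using hj
      rw [(hε j).resolve_right h1, neg_one_smul, neg_neg]
  have hmeas : ∀ B : Finset ι, AEStronglyMeasurable (fun ω => ∑ j ∈ B, ε j • Y j ω) P :=
    fun B => (integrable_finsetSum _ fun j _ => (hY j).smul (ε j)).1
  rw [e, two_mul]
  exact (eLpNorm_sub_le (hmeas A) (hmeas Aᶜ) hq).trans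
    (add_le_add (eLpNorm_sum_subset_le_of_iIndepFun hY h0 hind ε A hq)
      (eLpNorm_sum_subset_le_of_iIndepFun hY h0 hind ε Aᶜ hq))

end Symmetrization

/-! ### Minkowski's integral inequality and its discrete form. -/

section Minkowski

variable {α β : Type*} [MeasurableSpace α] [MeasurableSpace β] {μ : Measure α} {ν : Measure β}

/-- **Minkowski's integral inequality**. -/
theorem lintegral_lintegral_rpow_le [SFinite μ] [SFinite ν] {f : α → β → ℝ≥0∞}
    (hf : Measurable (Function.uncurry f)) {s : ℝ} (hs : 1 ≤ s)
    (hfin : ∫⁻ y, (∫⁻ x, f x y ∂μ) ^ s ∂ν ≠ ∞) :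
    (∫⁻ y, (∫⁻ x, f x y ∂μ) ^ s ∂ν) ^ (1 / s) ≤ ∫⁻ x, (∫⁻ y, f x y ^ s ∂ν) ^ (1 / s) ∂μ := by
  rcases hs.eq_or_lt with rfl | hs1
  · simp only [ENNReal.rpow_one, div_one]
    exact (lintegral_lintegral_swap hf.aemeasurable).ge
  set H : β → ℝ≥0∞ := fun y => ∫⁻ x, f x y ∂μ with hH
  have hHm : Measurable H := hf.lintegral_prod_left'
  set I := ∫⁻ y, H y ^ s ∂ν with hI
  rcases eq_or_ne I 0 with hI0 | hI0
  · rw [hI0, ENNReal.zero_rpow_of_pos (by positivity)]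
    exact zero_le
  have hpq := Real.HolderConjugate.conjExponent hs1
  set t := s.conjExponent
  -- Write `H^s = H · H^(s-1)`, expand one factor `H`, exchange the integrals and apply Hölder in
  -- `y`. The factor `I^(1/t)` is then cancelled, being neither zero nor infinite.
  have key : I ≤ (∫⁻ x, (∫⁻ y, f x y ^ s ∂ν) ^ (1 / s) ∂μ) * I ^ (1 / t) := by
    calc I = ∫⁻ y, ∫⁻ x, f x y * H y ^ (s - 1) ∂μ ∂ν := by
          refine lintegral_congr fun y => ?_
          rw [lintegral_mul_const _ hf.of_uncurry_right]
          conv_lhs => rw [show s = 1 + (s - 1) by ring,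
            ENNReal.rpow_add_of_nonneg _ _ zero_le_one (by linarith), ENNReal.rpow_one]
      _ = ∫⁻ x, ∫⁻ y, f x y * H y ^ (s - 1) ∂ν ∂μ := by
          refine lintegral_lintegral_swap ?_
          have h1 : Measurable fun z : β × α => f z.2 z.1 := hf.comp measurable_swap
          have h2 : Measurable fun z : β × α => H z.1 ^ (s - 1) :=
            (hHm.comp measurable_fst).pow_const _
          exact (h1.mul h2).aemeasurable
      _ ≤ ∫⁻ x, (∫⁻ y, f x y ^ s ∂ν) ^ (1 / s) * I ^ (1 / t) ∂μ :=
          lintegral_mono fun x =>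
            ENNReal.lintegral_mul_rpow_le_lintegral_rpow_mul_lintegral_rpow hpq
              hf.of_uncurry_left.aemeasurable hHm.aemeasurable
      _ = _ := by
          rw [lintegral_mul_const]
          exact (Measurable.lintegral_prod_right' (hf.pow_const s)).pow_const _
  have hIt0 : I ^ (1 / t) ≠ 0 := by simp [hI0, hfin]
  have hItt : I ^ (1 / t) ≠ ∞ := by simp [hI0, hfin]
  refine (ENNReal.mul_le_mul_iff_left hIt0 hItt).1 ?_
  rw [← ENNReal.rpow_add _ _ hI0 hfin]
  have : 1 / s + 1 / t = 1 := by simpa using hpq.inv_add_inv_eq_one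
  rw [this, ENNReal.rpow_one]
  exact key

theorem sum_rpow_le_rpow_sum {ι : Type*} (A : Finset ι) (d : ι → ℝ≥0∞) {s : ℝ} (hs : 1 ≤ s) :
    ∑ j ∈ A, d j ^ s ≤ (∑ j ∈ A, d j) ^ s := by
  classical
  induction A using Finset.induction_on with
  | empty => simp
  | insert j A hj ih =>
    rw [Finset.sum_insert hj, Finset.sum_insert hj]
    exact (add_le_add le_rfl ih).trans (ENNReal.add_rpow_le_rpow_add _ _ hs)

/-- The `L^q` norm of an `ℓ^a` norm is at most the `ℓ^a` norm of the `L^q` norms if `a ≤ q`. -/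
theorem lintegral_sum_rpow_le {ι : Type*} [Fintype ι] {f : ι → α → ℝ≥0∞}
    (hf : ∀ j, AEMeasurable (f j) μ) {a q : ℝ} (ha : 0 < a) (haq : a ≤ q) :
    (∫⁻ x, (∑ j, f j x ^ a) ^ (q / a) ∂μ) ^ (1 / q) ≤
      (∑ j, ((∫⁻ x, f j x ^ q ∂μ) ^ (1 / q)) ^ a) ^ (1 / a) := by
  have hq : 0 < q := ha.trans_le haq
  have h1 : 1 ≤ q / a := (one_le_div ha).2 haq
  -- The claim is the triangle inequality in `L^(q/a)` for the functions `f j ^ a`, raised to the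
  -- power `1/a`.
  have h := eLpNorm_sum_le (μ := μ) (s := Finset.univ) (f := fun j x => f j x ^ a)
    (p := ENNReal.ofReal (q / a)) (fun j _ => ((hf j).pow_const a).aestronglyMeasurable)
    (by simpa using h1)
  have hne : ENNReal.ofReal (q / a) ≠ 0 := by
    simp only [ne_eq, ENNReal.ofReal_eq_zero, not_le]; positivity
  simp only [eLpNorm_eq_lintegral_rpow_enorm_toReal hne ENNReal.ofReal_ne_top,
    ENNReal.toReal_ofReal (zero_le_one.trans h1), enorm_eq_self, Finset.sum_apply,
    ← ENNReal.rpow_mul] at h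
  have e : (1 : ℝ) / (q / a) = a / q := by field_simp
  have e2 : a * (q / a) = q := by field_simp
  rw [e, e2] at h
  calc (∫⁻ x, (∑ j, f j x ^ a) ^ (q / a) ∂μ) ^ (1 / q)
      = ((∫⁻ x, (∑ j, f j x ^ a) ^ (q / a) ∂μ) ^ (a / q)) ^ (1 / a) := by
        rw [← ENNReal.rpow_mul]; congr 1; field_simp
    _ ≤ (∑ j, (∫⁻ x, f j x ^ q ∂μ) ^ (a / q)) ^ (1 / a) := by gcongr
    _ = _ := by
        congr 1
        refine Finset.sum_congr rfl fun j _ => ?_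
        rw [← ENNReal.rpow_mul]; congr 1; field_simp

end Minkowski

/-! ### Khintchine bounds for finite sums and the type of `L^p(S)`. -/

section SignedSums

variable {R : Type} [MeasurableSpace R] {Q : Measure R} [IsProbabilityMeasure Q] [Q.IsComplete]
  {r : ℕ → R → ℝ}

theorem exists_nat_extension {E : Type*} [Zero E] {n : ℕ} (x : Fin n → E) :
    ∃ y : ℕ → E, ∀ j : Fin n, y j = x j :=
  ⟨fun j => if h : j < n then x ⟨j, h⟩ else 0, fun j => by simp⟩

theorem IsRademacherFamily.eLpNorm_fin_sum_le_kahaneKhintchineK {E : Type u}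
    [NormedAddCommGroup E] [NormedSpace ℝ E] [CompleteSpace E] (hr : IsRademacherFamily Q r)
    {q : ℝ≥0∞} (hq : q ≠ ∞) {n : ℕ} (x : Fin n → E) :
    eLpNorm (fun ω => ∑ j : Fin n, r j ω • x j) q Q ≤
      ENNReal.ofReal (kahaneKhintchineK.{u} q (min q 2)) *
        eLpNorm (fun ω => ∑ j : Fin n, r j ω • x j) (min q 2) Q := by
  obtain ⟨y, hy⟩ := exists_nat_extension x
  have h := hr.eLpNorm_le_kahaneKhintchineK hq n y
  simpa only [← Fin.sum_univ_eq_sum_range (fun j => r j _ • y j), hy] using h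

/-- Khintchine gives the `ℓ^2` norm of the coefficients, which is at most their `ℓ^t` norm for `t ≤
2`. -/
theorem IsRademacherFamily.lintegral_fin_sum_le_khintchineB (hr : IsRademacherFamily Q r)
    {q : ℝ≥0∞} (hq0 : q ≠ 0) (hq : q ≠ ∞) {t : ℝ} (ht0 : 0 < t) (ht2 : t ≤ 2) {n : ℕ}
    (a : Fin n → ℝ) :
    ∫⁻ ω, ‖∑ j : Fin n, r j ω * a j‖ₑ ^ q.toReal ∂Q ≤
      (ENNReal.ofReal (khintchineB q) * (∑ j, ‖a j‖ₑ ^ t) ^ (1 / t)) ^ q.toReal := by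
  obtain ⟨y, hy⟩ := exists_nat_extension a
  have h := hr.eLpNorm_le_khintchineB hq n y
  rw [← Fin.sum_univ_eq_sum_range (fun j => y j ^ 2)] at h
  simp only [← Fin.sum_univ_eq_sum_range (fun j => r j _ * y j), hy] at h
  have hq' : 0 < q.toReal := ENNReal.toReal_pos hq0 hq
  rw [eLpNorm_eq_lintegral_rpow_enorm_toReal hq0 hq, one_div, ENNReal.rpow_inv_le_iff hq'] at h
  refine h.trans ?_
  gcongr
  have hs : (1 : ℝ) ≤ 2 / t := (one_le_div ht0).2 ht2
  have h2 := sum_rpow_le_rpow_sum Finset.univ (fun j => ‖a j‖ₑ ^ t) hs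
  simp only [← ENNReal.rpow_mul, mul_div_cancel₀ (2 : ℝ) ht0.ne'] at h2
  have e : ENNReal.ofReal (∑ j, a j ^ 2) = ∑ j, ‖a j‖ₑ ^ (2 : ℝ) := by
    rw [ENNReal.ofReal_sum_of_nonneg fun _ _ => sq_nonneg _]
    refine Finset.sum_congr rfl fun j _ => ?_
    rw [Real.enorm_eq_ofReal_abs, ENNReal.rpow_ofNat, ← ENNReal.ofReal_pow (abs_nonneg _), sq_abs]
  rw [Real.sqrt_eq_rpow, ← ENNReal.ofReal_rpow_of_nonneg
    (Finset.sum_nonneg fun _ _ => sq_nonneg _) (by norm_num), e]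
  calc (∑ j, ‖a j‖ₑ ^ (2 : ℝ)) ^ (1 / 2 : ℝ)
      ≤ ((∑ j, ‖a j‖ₑ ^ t) ^ (2 / t)) ^ (1 / 2 : ℝ) := by gcongr
    _ = _ := by rw [← ENNReal.rpow_mul]; congr 1; field_simp

theorem Lp_coeFn_sum_smul {S : Type*} [MeasurableSpace S] {μ : Measure S} {p : ℝ≥0∞}
    {ι : Type*} (A : Finset ι) (c : ι → ℝ) (y : ι → Lp ℝ p μ) :
    ((∑ j ∈ A, c j • y j : Lp ℝ p μ) : S → ℝ) =ᵐ[μ] fun s => ∑ j ∈ A, c j * y j s := by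
  classical
  induction A using Finset.induction_on with
  | empty =>
    simp only [Finset.sum_empty]
    exact Lp.coeFn_zero _ _ _
  | insert j A hj ih =>
    rw [Finset.sum_insert hj]
    filter_upwards [Lp.coeFn_add (c j • y j) (∑ j ∈ A, c j • y j), Lp.coeFn_smul (c j) (y j), ih]
      with s h1 h2 h3
    rw [h1, Pi.add_apply, h2, h3, Finset.sum_insert hj, Pi.smul_apply, smul_eq_mul]

theorem Lp_enorm_rpow_eq {S : Type*} [MeasurableSpace S] {μ : Measure S} {p : ℝ≥0∞}
    [hp1 : Fact (1 ≤ p)] (hp : p ≠ ∞) (f : Lp ℝ p μ) :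
    ‖f‖ₑ ^ p.toReal = ∫⁻ s, ‖f s‖ₑ ^ p.toReal ∂μ := by
  have hp0 : p ≠ 0 := (zero_lt_one.trans_le hp1.out).ne'
  rw [Lp.enorm_def, eLpNorm_eq_lintegral_rpow_enorm_toReal hp0 hp, ← ENNReal.rpow_mul,
    one_div_mul_cancel (ENNReal.toReal_pos hp0 hp).ne', ENNReal.rpow_one]

/-- Type inequality for `L^p`. -/
theorem IsRademacherFamily.eLpNorm_fin_sum_Lp_le {S : Type*} [MeasurableSpace S] {μ : Measure S}
    [SFinite μ] (hr : IsRademacherFamily Q r) {p : ℝ≥0∞} [hp1 : Fact (1 ≤ p)] (hp : p ≠ ∞) {t : ℝ}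
    (ht0 : 0 < t) (ht2 : t ≤ 2) (htp : t ≤ p.toReal) {n : ℕ} (y : Fin n → Lp ℝ p μ) :
    eLpNorm (fun ω => ∑ j : Fin n, r j ω • y j) p Q ≤
      ENNReal.ofReal (khintchineB p) * (∑ j, ‖y j‖ₑ ^ t) ^ (1 / t) := by
  have hp0 : p ≠ 0 := (zero_lt_one.trans_le hp1.out).ne'
  have hp' : 0 < p.toReal := ENNReal.toReal_pos hp0 hp
  have hm : ∀ j, Measurable fun s => y j s := fun j => (Lp.stronglyMeasurable (y j)).measurable
  have h1 : ∫⁻ ω, ‖∑ j : Fin n, r j ω • y j‖ₑ ^ p.toReal ∂Q ≤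
      ENNReal.ofReal (khintchineB p) ^ p.toReal *
        ∫⁻ s, (∑ j, ‖y j s‖ₑ ^ t) ^ (p.toReal / t) ∂μ := by
    -- Taking the exponent `p` in both variables lets Fubini put the signs inside, where scalar
    -- Khintchine applies at each `s`.
    calc ∫⁻ ω, ‖∑ j : Fin n, r j ω • y j‖ₑ ^ p.toReal ∂Q
        = ∫⁻ ω, ∫⁻ s, ‖∑ j : Fin n, r j ω * y j s‖ₑ ^ p.toReal ∂μ ∂Q := by
          refine lintegral_congr fun ω => ?_
          rw [Lp_enorm_rpow_eq hp]
          refine lintegral_congr_ae ?_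
          filter_upwards [Lp_coeFn_sum_smul Finset.univ (fun j : Fin n => r j ω) y] with s hs
          rw [hs]
      _ = ∫⁻ s, ∫⁻ ω, ‖∑ j : Fin n, r j ω * y j s‖ₑ ^ p.toReal ∂Q ∂μ := by
          refine lintegral_lintegral_swap (Measurable.aemeasurable ?_)
          refine (Measurable.enorm ?_).pow_const _
          exact Finset.measurable_fun_sum _ fun j _ =>
            ((hr.measurable j).comp measurable_fst).mul ((hm j).comp measurable_snd)
      _ ≤ ∫⁻ s, ENNReal.ofReal (khintchineB p) ^ p.toReal *
            (∑ j, ‖y j s‖ₑ ^ t) ^ (p.toReal / t) ∂μ := by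
          refine lintegral_mono fun s => ?_
          refine (hr.lintegral_fin_sum_le_khintchineB hp0 hp ht0 ht2 fun j => y j s).trans_eq ?_
          rw [ENNReal.mul_rpow_of_nonneg _ _ hp'.le, ← ENNReal.rpow_mul, one_div_mul_eq_div]
      _ = _ := by
          refine lintegral_const_mul _ (Measurable.pow_const ?_ _)
          exact Finset.measurable_fun_sum _ fun j _ => (hm j).enorm.pow_const _
  have h2 := lintegral_sum_rpow_le (μ := μ) (f := fun j s => ‖y j s‖ₑ)
    (fun j => (hm j).enorm.aemeasurable) ht0 htp
  rw [eLpNorm_eq_lintegral_rpow_enorm_toReal hp0 hp]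
  calc (∫⁻ ω, ‖∑ j : Fin n, r j ω • y j‖ₑ ^ p.toReal ∂Q) ^ (1 / p.toReal)
      ≤ (ENNReal.ofReal (khintchineB p) ^ p.toReal *
        ∫⁻ s, (∑ j, ‖y j s‖ₑ ^ t) ^ (p.toReal / t) ∂μ) ^ (1 / p.toReal) := by gcongr
    _ = ENNReal.ofReal (khintchineB p) *
        (∫⁻ s, (∑ j, ‖y j s‖ₑ ^ t) ^ (p.toReal / t) ∂μ) ^ (1 / p.toReal) := by
        rw [ENNReal.mul_rpow_of_nonneg _ _ (by positivity), ← ENNReal.rpow_mul,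
          mul_one_div_cancel hp'.ne', ENNReal.rpow_one]
    _ ≤ _ := by
        gcongr
        refine h2.trans_eq ?_
        congr 1
        refine Finset.sum_congr rfl fun j _ => ?_
        rw [← Lp_enorm_rpow_eq hp, ← ENNReal.rpow_mul, ← ENNReal.rpow_mul, ← mul_assoc,
          mul_one_div_cancel hp'.ne', one_mul]

theorem sum_const_rpow_rpow_one_div {t : ℝ} (ht : 0 < t) (M : ℕ) (N : ℝ≥0∞) :
    (∑ _j : Fin M, N ^ t) ^ (1 / t) = (M : ℝ≥0∞) ^ (1 / t) * N := by
  rw [Finset.sum_const, Finset.card_univ, Fintype.card_fin, nsmul_eq_mul,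
    ENNReal.mul_rpow_of_nonneg _ _ (by positivity), ← ENNReal.rpow_mul,
    mul_one_div_cancel ht.ne', ENNReal.rpow_one]

end SignedSums

/-! ### Symmetrization averaged over random signs. -/

section Randomization

variable {R : Type} [MeasurableSpace R] {Q : Measure R} [IsProbabilityMeasure Q] {r : ℕ → R → ℝ}
  {Ω : Type*} [MeasurableSpace Ω] {P : Measure Ω}
  {E : Type*} [NormedAddCommGroup E] [NormedSpace ℝ E]

theorem IsRademacherFamily.memLp_prod_sum (hr : IsRademacherFamily Q r) {q : ℝ≥0∞} {M : ℕ}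
    {Y : Fin M → Ω → E} (hY : ∀ j, MemLp (Y j) q P) :
    MemLp (fun z : Ω × R => ∑ j : Fin M, r j z.2 • Y j z.1) q (P.prod Q) := by
  refine memLp_finsetSum _ fun j _ => ?_
  have h1 : MemLp (fun z : Ω × R => Y j z.1) q (P.prod Q) := (hY j).comp_fst Q
  refine h1.of_le (((hr.measurable j).comp measurable_snd).aestronglyMeasurable.smul h1.1)
    (ae_of_all _ fun z => ?_)
  rcases hr.values j z.2 with h | h <;> simp [h]

/-- Symmetrization averaged over the signs. -/
theorem IsRademacherFamily.eLpNorm_sum_rpow_le [IsProbabilityMeasure P] [CompleteSpace E]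
    [MeasurableSpace E] [BorelSpace E] (hr : IsRademacherFamily Q r) {q : ℝ≥0∞} (hq1 : 1 ≤ q) (hq : q ≠ ∞) {M : ℕ}
    {Y : Fin M → Ω → E} (hY : ∀ j, MemLp (Y j) q P) (h0 : ∀ j, ∫ ω, Y j ω ∂P = 0)
    (hind : iIndepFun Y P) :
    eLpNorm (fun ω => ∑ j, Y j ω) q P ^ q.toReal ≤
      2 ^ q.toReal * ∫⁻ ω, ∫⁻ ω', ‖∑ j : Fin M, r j ω' • Y j ω‖ₑ ^ q.toReal ∂Q ∂P := by
  have hq0 : q ≠ 0 := (zero_lt_one.trans_le hq1).ne'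
  have hq' : 0 < q.toReal := ENNReal.toReal_pos hq0 hq
  have hswap : ∫⁻ ω, ∫⁻ ω', ‖∑ j : Fin M, r j ω' • Y j ω‖ₑ ^ q.toReal ∂Q ∂P =
      ∫⁻ ω', ∫⁻ ω, ‖∑ j : Fin M, r j ω' • Y j ω‖ₑ ^ q.toReal ∂P ∂Q :=
    lintegral_lintegral_swap ((hr.memLp_prod_sum hY).1.enorm.pow_const _)
  rw [hswap, ← lintegral_const_mul' _ _ (by simp)]
  calc eLpNorm (fun ω => ∑ j, Y j ω) q P ^ q.toReal
      = ∫⁻ _ω' : R, eLpNorm (fun ω => ∑ j, Y j ω) q P ^ q.toReal ∂Q := by simp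
    _ ≤ _ := by
        refine lintegral_mono fun ω' => ?_
        have h := eLpNorm_sum_le_two_mul_eLpNorm_sum_smul (fun j => (hY j).integrable hq1) h0 hind
          (ε := fun j : Fin M => r j ω') (fun j => hr.values j ω') hq1
        refine (ENNReal.rpow_le_rpow h hq'.le).trans_eq ?_
        rw [ENNReal.mul_rpow_of_nonneg _ _ hq'.le,
          eLpNorm_eq_lintegral_rpow_enorm_toReal (f := fun ω => ∑ j : Fin M, r j ω' • Y j ω) hq0 hq,
          ← ENNReal.rpow_mul, one_div_mul_cancel hq'.ne', ENNReal.rpow_one]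

end Randomization

/-! ### Sums of independent centred variables in the cases `q < p` and `p ≤ q`. -/

section MonteCarloBounds

theorem min_two_toReal_bounds {q : ℝ≥0∞} (h1 : 1 ≤ q) (hq : q ≠ ∞) :
    0 < (min q 2).toReal ∧ (min q 2).toReal ≤ 2 ∧ (min q 2).toReal ≤ q.toReal := by
  refine ⟨ENNReal.toReal_pos ?_ ?_, ?_, ENNReal.toReal_mono hq (min_le_left _ _)⟩
  · exact (zero_lt_one.trans_le (le_min h1 one_le_two)).ne'
  · exact ne_top_of_le_ne_top hq (min_le_left _ _)
  · exact ENNReal.toReal_mono (b := 2) ENNReal.ofNat_ne_top (min_le_right _ _)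

variable {R : Type} [MeasurableSpace R] {Q : Measure R} [IsProbabilityMeasure Q] [Q.IsComplete]
  {r : ℕ → R → ℝ} {S : Type u} {Ω : Type v} [MeasurableSpace S] [MeasurableSpace Ω]
  {μ : Measure S} {P : Measure Ω} {p q : ℝ≥0∞} [hp1 : Fact (1 ≤ p)] [hq1 : Fact (1 ≤ q)]

theorem IsRademacherFamily.lintegral_prod_fin_sum_le (hr : IsRademacherFamily Q r) (hq : q ≠ ∞)
    {M : ℕ} {h : Fin M → Ω → ℝ} (hm : ∀ j, Measurable (h j)) {N : ℝ≥0∞}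
    (hN : ∀ j, (∫⁻ ω, ‖h j ω‖ₑ ^ q.toReal ∂P) ^ (1 / q.toReal) = N) :
    (∫⁻ z : Ω × R, ‖∑ j : Fin M, r j z.2 * h j z.1‖ₑ ^ q.toReal ∂(P.prod Q)) ^ (1 / q.toReal) ≤
      ENNReal.ofReal (khintchineB q) * ((M : ℝ≥0∞) ^ (1 / (min q 2).toReal) * N) := by
  have hq0 : q ≠ 0 := (zero_lt_one.trans_le hq1.out).ne'
  have hq' : 0 < q.toReal := ENNReal.toReal_pos hq0 hq
  obtain ⟨ht0, ht2, htq⟩ := min_two_toReal_bounds hq1.out hq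
  set t := (min q 2).toReal
  set B := ENNReal.ofReal (khintchineB q)
  have hzm : Measurable fun z : Ω × R => ∑ j : Fin M, r j z.2 * h j z.1 :=
    Finset.measurable_fun_sum _ fun j _ =>
      ((hr.measurable j).comp measurable_snd).mul ((hm j).comp measurable_fst)
  have h1 : ∫⁻ z : Ω × R, ‖∑ j : Fin M, r j z.2 * h j z.1‖ₑ ^ q.toReal ∂(P.prod Q) ≤
      B ^ q.toReal * ∫⁻ ω, (∑ j, ‖h j ω‖ₑ ^ t) ^ (q.toReal / t) ∂P := by
    rw [lintegral_prod _ (hzm.enorm.pow_const _).aemeasurable,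
      ← lintegral_const_mul' _ _ (ENNReal.rpow_ne_top_of_nonneg hq'.le ENNReal.ofReal_ne_top)]
    refine lintegral_mono fun ω => ?_
    refine (hr.lintegral_fin_sum_le_khintchineB hq0 hq ht0 ht2 fun j => h j ω).trans_eq ?_
    rw [ENNReal.mul_rpow_of_nonneg _ _ hq'.le, ← ENNReal.rpow_mul, one_div_mul_eq_div]
  have h2 := lintegral_sum_rpow_le (μ := P) (f := fun j ω => ‖h j ω‖ₑ)
    (fun j => (hm j).enorm.aemeasurable) ht0 htq
  simp only [hN] at h2
  rw [sum_const_rpow_rpow_one_div ht0] at h2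
  refine (ENNReal.rpow_le_rpow h1 (by positivity)).trans ?_
  rw [ENNReal.mul_rpow_of_nonneg _ _ (by positivity), ← ENNReal.rpow_mul,
    mul_one_div_cancel hq'.ne', ENNReal.rpow_one]
  gcongr

variable [SigmaFinite μ] [IsProbabilityMeasure P]

/-- For fixed `ω`, Kahane–Khintchine followed by the type inequality bounds the Rademacher average
by the `ℓ^t` norm of the `‖Y j ω‖`. Since `t ≤ q`, the `L^q` norm in `ω` then moves inside the `ℓ^t`
norm. -/
theorem IsRademacherFamily.eLpNorm_sum_le_of_lt [MeasurableSpace (Lp ℝ p μ)]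
    [BorelSpace (Lp ℝ p μ)] (hr : IsRademacherFamily Q r) (hp : p ≠ ∞) (hqp : q < p) {M : ℕ}
    {Y : Fin M → Ω → Lp ℝ p μ} (hY : ∀ j, MemLp (Y j) q P) (h0 : ∀ j, ∫ ω, Y j ω ∂P = 0)
    (hind : iIndepFun Y P) {N : ℝ≥0∞} (hN : ∀ j, eLpNorm (Y j) q P = N) :
    eLpNorm (fun ω => ∑ j, Y j ω) q P ≤
      2 * ENNReal.ofReal (kahaneKhintchineK.{u} q (min q 2)) * ENNReal.ofReal (khintchineB p) *
        ((M : ℝ≥0∞) ^ (1 / (min q 2).toReal) * N) := by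
  have hq : q ≠ ∞ := hqp.ne_top
  have hq0 : q ≠ 0 := (zero_lt_one.trans_le hq1.out).ne'
  have hq' : 0 < q.toReal := ENNReal.toReal_pos hq0 hq
  obtain ⟨ht0, ht2, htq⟩ := min_two_toReal_bounds hq1.out hq
  set t := (min q 2).toReal
  have htp : t ≤ p.toReal := htq.trans (ENNReal.toReal_mono hp hqp.le)
  set K := ENNReal.ofReal (kahaneKhintchineK.{u} q (min q 2))
  set B := ENNReal.ofReal (khintchineB p)
  have h1 : ∀ ω, ∫⁻ ω', ‖∑ j : Fin M, r j ω' • Y j ω‖ₑ ^ q.toReal ∂Q ≤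
      (K * B) ^ q.toReal * (∑ j, ‖Y j ω‖ₑ ^ t) ^ (q.toReal / t) := by
    intro ω
    have hm : AEStronglyMeasurable (fun ω' => ∑ j : Fin M, r j ω' • Y j ω) Q :=
      (Finset.stronglyMeasurable_fun_sum _ fun (j : Fin M) _ =>
        (hr.measurable j).stronglyMeasurable.smul_const (Y j ω)).aestronglyMeasurable
    have h := (hr.eLpNorm_fin_sum_le_kahaneKhintchineK hq fun j => Y j ω).trans
      (mul_le_mul' le_rfl ((eLpNorm_le_eLpNorm_of_exponent_le
        ((min_le_left q 2).trans hqp.le) hm).trans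
        (hr.eLpNorm_fin_sum_Lp_le hp ht0 ht2 htp fun j => Y j ω)))
    rw [eLpNorm_eq_lintegral_rpow_enorm_toReal hq0 hq, one_div, ENNReal.rpow_inv_le_iff hq',
      ← mul_assoc, ENNReal.mul_rpow_of_nonneg _ _ hq'.le, ← ENNReal.rpow_mul,
      one_div_mul_eq_div] at h
    exact h
  have hKB : (K * B) ^ q.toReal ≠ ∞ :=
    ENNReal.rpow_ne_top_of_nonneg hq'.le (ENNReal.mul_ne_top ENNReal.ofReal_ne_top
      ENNReal.ofReal_ne_top)
  have h2 := lintegral_sum_rpow_le (μ := P) (f := fun j ω => ‖Y j ω‖ₑ)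
    (fun j => (hY j).1.enorm) ht0 htq
  have h3 := hr.eLpNorm_sum_rpow_le hq1.out hq hY h0 hind
  have h4 : eLpNorm (fun ω => ∑ j, Y j ω) q P ^ q.toReal ≤
      (2 * K * B) ^ q.toReal * ∫⁻ ω, (∑ j, ‖Y j ω‖ₑ ^ t) ^ (q.toReal / t) ∂P := by
    refine h3.trans ?_
    rw [mul_assoc, ENNReal.mul_rpow_of_nonneg _ _ hq'.le, mul_assoc]
    gcongr
    rw [← lintegral_const_mul' _ _ hKB]
    exact lintegral_mono h1
  have h5 : eLpNorm (fun ω => ∑ j, Y j ω) q P ≤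
      2 * K * B * (∫⁻ ω, (∑ j, ‖Y j ω‖ₑ ^ t) ^ (q.toReal / t) ∂P) ^ (1 / q.toReal) := by
    rw [← ENNReal.rpow_le_rpow_iff hq', ENNReal.mul_rpow_of_nonneg _ _ hq'.le,
      ← ENNReal.rpow_mul, one_div_mul_cancel hq'.ne', ENNReal.rpow_one]
    exact h4
  refine h5.trans ?_
  gcongr
  refine h2.trans_eq ?_
  have e : ∀ j, (∫⁻ ω, ‖Y j ω‖ₑ ^ q.toReal ∂P) ^ (1 / q.toReal) = N := fun j => by
    rw [← hN j, eLpNorm_eq_lintegral_rpow_enorm_toReal hq0 hq]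
  simp only [e]
  exact sum_const_rpow_rpow_one_div ht0 M N

theorem IsRademacherFamily.eLpNorm_sum_le_of_le [MeasurableSpace (Lp ℝ p μ)]
    [BorelSpace (Lp ℝ p μ)] (hr : IsRademacherFamily Q r) (hq : q ≠ ∞) (hpq : p ≤ q) {M : ℕ}
    {Y : Fin M → Ω → Lp ℝ p μ} (hY : ∀ j, MemLp (Y j) q P) (h0 : ∀ j, ∫ ω, Y j ω ∂P = 0)
    (hind : iIndepFun Y P) {g : Fin M → S × Ω → ℝ} (hg : ∀ j, Measurable (g j))
    (hYg : ∀ j, ∀ᵐ ω ∂P, (Y j ω : S → ℝ) =ᵐ[μ] fun s => g j (s, ω)) {N : S → ℝ≥0∞}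
    (hN : ∀ j, ∀ᵐ s ∂μ, (∫⁻ ω, ‖g j (s, ω)‖ₑ ^ q.toReal ∂P) ^ (1 / q.toReal) = N s) :
    eLpNorm (fun ω => ∑ j, Y j ω) q P ≤
      2 * ENNReal.ofReal (khintchineB q) * ((M : ℝ≥0∞) ^ (1 / (min q 2).toReal) *
        (∫⁻ s, N s ^ p.toReal ∂μ) ^ (1 / p.toReal)) := by
  have hp : p ≠ ∞ := ne_top_of_le_ne_top hq hpq
  have hp0 : p ≠ 0 := (zero_lt_one.trans_le hp1.out).ne'
  have hp' : 0 < p.toReal := ENNReal.toReal_pos hp0 hp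
  have hq0 : q ≠ 0 := (zero_lt_one.trans_le hq1.out).ne'
  have hq' : 0 < q.toReal := ENNReal.toReal_pos hq0 hq
  have hpq' : p.toReal ≤ q.toReal := ENNReal.toReal_mono hq hpq
  obtain ⟨ht0, ht2, htq⟩ := min_two_toReal_bounds hq1.out hq
  set t := (min q 2).toReal
  set B := ENNReal.ofReal (khintchineB q)
  set f : S → Ω × R → ℝ≥0∞ := fun s z => ‖∑ j : Fin M, r j z.2 * g j (s, z.1)‖ₑ ^ p.toReal with hf
  have hgm : Measurable fun z : S × Ω × R => ∑ j : Fin M, r j z.2.2 * g j (z.1, z.2.1) :=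
    Finset.measurable_fun_sum _ fun j _ =>
      ((hr.measurable j).comp (measurable_snd.comp measurable_snd)).mul
        ((hg j).comp (measurable_fst.prodMk (measurable_fst.comp measurable_snd)))
  have hfm : Measurable (Function.uncurry f) := hgm.enorm.pow_const _
  have hall : ∀ᵐ ω ∂P, ∀ j, (Y j ω : S → ℝ) =ᵐ[μ] fun s => g j (s, ω) := ae_all_iff.2 hYg
  have hnorm : ∀ᵐ ω ∂P, ∀ ω', ‖∑ j : Fin M, r j ω' • Y j ω‖ₑ ^ q.toReal =
      (∫⁻ s, f s (ω, ω') ∂μ) ^ (q.toReal / p.toReal) := by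
    filter_upwards [hall] with ω hω ω'
    have e : ∫⁻ s, f s (ω, ω') ∂μ = ‖∑ j : Fin M, r j ω' • Y j ω‖ₑ ^ p.toReal := by
      rw [Lp_enorm_rpow_eq hp]
      refine lintegral_congr_ae ?_
      filter_upwards [Lp_coeFn_sum_smul Finset.univ (fun j : Fin M => r j ω') fun j => Y j ω,
        ae_all_iff.2 hω] with s h1 h2
      simp only [hf, h1, h2]
    rw [e, ← ENNReal.rpow_mul, mul_div_cancel₀ _ hp'.ne']
  have hprod : ∫⁻ z, (∫⁻ s, f s z ∂μ) ^ (q.toReal / p.toReal) ∂(P.prod Q) =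
      ∫⁻ ω, ∫⁻ ω', ‖∑ j : Fin M, r j ω' • Y j ω‖ₑ ^ q.toReal ∂Q ∂P := by
    have hHm : Measurable fun z => ∫⁻ s, f s z ∂μ := hfm.lintegral_prod_left'
    rw [lintegral_prod _ (hHm.pow_const _).aemeasurable]
    refine lintegral_congr_ae ?_
    filter_upwards [hnorm] with ω hω
    exact lintegral_congr fun ω' => (hω ω').symm
  -- Minkowski is available only for a finite left side; finiteness comes from `Y j ∈ L^q` and
  -- bounded signs.
  have hfin : ∫⁻ z, (∫⁻ s, f s z ∂μ) ^ (q.toReal / p.toReal) ∂(P.prod Q) ≠ ∞ := by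
    have h := hr.memLp_prod_sum hY
    have h2 := lintegral_rpow_enorm_lt_top_of_eLpNorm_lt_top hq0 hq h.2
    rw [lintegral_prod _ (h.1.enorm.pow_const _)] at h2
    rw [hprod]
    exact h2.ne
  -- Here `p ≤ q` enters: Minkowski with exponent `q/p ≥ 1` moves the integral over `S` outside.
  have hmink := lintegral_lintegral_rpow_le hfm ((one_le_div hp').2 hpq') hfin
  rw [hprod, one_div_div] at hmink
  have hpt : ∀ᵐ s ∂μ, (∫⁻ z, f s z ^ (q.toReal / p.toReal) ∂(P.prod Q)) ^ (p.toReal / q.toReal) ≤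
      (B * (M : ℝ≥0∞) ^ (1 / t)) ^ p.toReal * N s ^ p.toReal := by
    filter_upwards [ae_all_iff.2 hN] with s hs
    have h1 := hr.lintegral_prod_fin_sum_le hq (fun j => (hg j).comp measurable_prodMk_left) hs
    have e : ∫⁻ z, f s z ^ (q.toReal / p.toReal) ∂(P.prod Q) =
        ∫⁻ z, ‖∑ j : Fin M, r j z.2 * g j (s, z.1)‖ₑ ^ q.toReal ∂(P.prod Q) :=
      lintegral_congr fun z => by
        rw [hf, ← ENNReal.rpow_mul, mul_div_cancel₀ _ hp'.ne']
    rw [e, ← ENNReal.mul_rpow_of_nonneg _ _ hp'.le, mul_assoc, ← one_div_mul_eq_div,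
      ENNReal.rpow_mul]
    exact ENNReal.rpow_le_rpow h1 hp'.le
  have hBM : (B * (M : ℝ≥0∞) ^ (1 / t)) ^ p.toReal ≠ ∞ :=
    ENNReal.rpow_ne_top_of_nonneg hp'.le (ENNReal.mul_ne_top ENNReal.ofReal_ne_top
      (ENNReal.rpow_ne_top_of_nonneg (by positivity) (ENNReal.natCast_ne_top M)))
  have h6 := hmink.trans (lintegral_mono_ae hpt)
  rw [lintegral_const_mul' _ _ hBM] at h6
  have h3 := hr.eLpNorm_sum_rpow_le hq1.out hq hY h0 hind
  set D := ∫⁻ ω, ∫⁻ ω', ‖∑ j : Fin M, r j ω' • Y j ω‖ₑ ^ q.toReal ∂Q ∂P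
  calc eLpNorm (fun ω => ∑ j, Y j ω) q P ≤ 2 * D ^ (1 / q.toReal) := by
        rw [← ENNReal.rpow_le_rpow_iff hq', ENNReal.mul_rpow_of_nonneg _ _ hq'.le,
          ← ENNReal.rpow_mul, one_div_mul_cancel hq'.ne', ENNReal.rpow_one]
        exact h3
    _ = 2 * (D ^ (p.toReal / q.toReal)) ^ (1 / p.toReal) := by
        rw [← ENNReal.rpow_mul]; congr 2; field_simp
    _ ≤ 2 * ((B * (M : ℝ≥0∞) ^ (1 / t)) ^ p.toReal * ∫⁻ s, N s ^ p.toReal ∂μ) ^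
          (1 / p.toReal) := by gcongr
    _ = _ := by
        rw [ENNReal.mul_rpow_of_nonneg _ _ (by positivity), ← ENNReal.rpow_mul,
          mul_one_div_cancel hp'.ne', ENNReal.rpow_one]
        ring

end MonteCarloBounds

/-! ### Section maps, the mixed norm and equality of section moments. -/

section SectionMaps

variable {S : Type u} {Ω : Type v} [MeasurableSpace S] [MeasurableSpace Ω]
  {μ : Measure S} {P : Measure Ω} {p q : ℝ≥0∞} [hq1 : Fact (1 ≤ q)]

theorem ae_coeFn_sub_eq {X : Ω → Lp ℝ p μ} {g : S × Ω → ℝ}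
    (h : ∀ᵐ ω ∂P, (X ω : S → ℝ) =ᵐ[μ] fun s => g (s, ω)) (c : Lp ℝ p μ) :
    ∀ᵐ ω ∂P, ((X ω - c : Lp ℝ p μ) : S → ℝ) =ᵐ[μ] fun s => g (s, ω) - c s := by
  filter_upwards [h] with ω hω
  filter_upwards [Lp.coeFn_sub (X ω) c, hω] with s h1 h2
  rw [h1, Pi.sub_apply, h2]

theorem MemMixed.eMixedNorm_ne_top {X : Ω → Lp ℝ p μ} (hX : MemMixed q μ P X) :
    eMixedNorm q μ P X ≠ ∞ := by
  obtain ⟨F, hF, hFp⟩ := hX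
  exact ne_top_of_le_ne_top hFp.eLpNorm_ne_top (iInf₂_le F hF)

/-- The section map of the constant variable `c` sends `s` to the constant function `c s` on `Ω`,
and is in `L^p(S; L^q(Ω))` because `P` is finite. -/
theorem MemMixed.sub_const [IsProbabilityMeasure P] {X : Ω → Lp ℝ p μ} (hX : MemMixed q μ P X) (c : Lp ℝ p μ) :
    MemMixed q μ P fun ω => X ω - c := by
  obtain ⟨F, ⟨-, g, hg, hXg, hFg⟩, hFp⟩ := hX
  have hG : MemLp (fun s => F s - Lp.constL q P ℝ (c s)) p μ :=
    hFp.sub ((Lp.constL q P ℝ : ℝ →L[ℝ] Lp ℝ q P).comp_memLp' (Lp.memLp c))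
  refine ⟨_, ⟨hG.1, fun z => g z - c z.1, hg.sub
    ((Lp.stronglyMeasurable c).measurable.comp measurable_fst), ae_coeFn_sub_eq hXg c, ?_⟩, hG⟩
  filter_upwards [hFg] with s hs
  have hconst : (Lp.constL q P ℝ (c s) : Ω → ℝ) =ᵐ[P] Function.const Ω (c s) :=
    Lp.coeFn_const q P (c s)
  filter_upwards [Lp.coeFn_sub (F s) (Lp.constL q P ℝ (c s)), hs, hconst] with ω h1 h2 h3
  rw [h1, Pi.sub_apply, h2, h3, Function.const_apply]

variable [hp1 : Fact (1 ≤ p)]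

theorem constSL_nonneg (X : Ω → Lp ℝ p μ) : 0 ≤ constSL q μ P X := by
  have h1 := khintchineB_nonneg p
  have h2 := khintchineB_nonneg q
  have h3 := kahaneKhintchineK_nonneg.{u} q (min q 2)
  rw [constSL]
  split_ifs <;> positivity

/-- Fatou along an almost everywhere convergent subsequence makes these functionals lower
semicontinuous. Their measurability is what transfers equality in law to section moments. -/
theorem measurable_setLIntegral_enorm_rpow_Lp [MeasurableSpace (Lp ℝ p μ)] [BorelSpace (Lp ℝ p μ)]
    (A : Set S) (c : ℝ) :
    Measurable fun f : Lp ℝ p μ => ∫⁻ s in A, ‖f s‖ₑ ^ c ∂μ := by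
  refine LowerSemicontinuous.measurable ?_
  rw [lowerSemicontinuous_iff_isClosed_preimage]
  refine fun b => IsSeqClosed.isClosed fun f f₀ hf hlim => ?_
  obtain ⟨φ, -, hφ⟩ := (tendstoInMeasure_of_tendsto_Lp hlim).exists_seq_tendsto_ae
  have hm : ∀ n, Measurable fun s => ‖f (φ n) s‖ₑ ^ c := fun n =>
    (Lp.stronglyMeasurable (f (φ n))).measurable.enorm.pow_const c
  have hl : ∀ᵐ s ∂(μ.restrict A), ‖f₀ s‖ₑ ^ c = liminf (fun n => ‖f (φ n) s‖ₑ ^ c) atTop := by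
    filter_upwards [ae_restrict_of_ae hφ] with s hs
    exact ((ENNReal.continuous_rpow_const.tendsto _).comp
      ((continuous_enorm.tendsto _).comp hs)).liminf_eq.symm
  simp only [Set.mem_preimage, Set.mem_Iic] at hf ⊢
  rw [lintegral_congr_ae hl]
  refine (lintegral_liminf_le hm).trans ?_
  refine liminf_le_of_frequently_le' (Frequently.of_forall fun n => hf (φ n))

variable [IsProbabilityMeasure P] [SigmaFinite μ]

/-- Identically distributed random variables in `L^p(S)` have sections with equal moments. -/
theorem ae_lintegral_section_eq_of_identDistrib [MeasurableSpace (Lp ℝ p μ)]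
    [BorelSpace (Lp ℝ p μ)] {Y Z : Ω → Lp ℝ p μ} (hYZ : IdentDistrib Y Z P P) {g h : S × Ω → ℝ}
    (hg : Measurable g) (hh : Measurable h)
    (hYg : ∀ᵐ ω ∂P, (Y ω : S → ℝ) =ᵐ[μ] fun s => g (s, ω))
    (hZh : ∀ᵐ ω ∂P, (Z ω : S → ℝ) =ᵐ[μ] fun s => h (s, ω)) (c : ℝ) :
    ∀ᵐ s ∂μ, ∫⁻ ω, ‖g (s, ω)‖ₑ ^ c ∂P = ∫⁻ ω, ‖h (s, ω)‖ₑ ^ c ∂P := by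
  have key : ∀ {W : Ω → Lp ℝ p μ} {k : S × Ω → ℝ}, Measurable k →
      (∀ᵐ ω ∂P, (W ω : S → ℝ) =ᵐ[μ] fun s => k (s, ω)) → ∀ A : Set S,
      ∫⁻ s in A, ∫⁻ ω, ‖k (s, ω)‖ₑ ^ c ∂P ∂μ = ∫⁻ ω, ∫⁻ s in A, ‖W ω s‖ₑ ^ c ∂μ ∂P := by
    intro W k hk hW A
    rw [lintegral_lintegral_swap (hk.enorm.pow_const c).aemeasurable]
    refine lintegral_congr_ae ?_
    filter_upwards [hW] with ω hω
    refine lintegral_congr_ae ?_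
    filter_upwards [ae_restrict_of_ae hω] with s hs
    rw [hs]
  -- Integrated over `A`, each section moment becomes the expectation of a measurable functional of
  -- the variable, which depends only on its law.
  refine ae_eq_of_forall_setLIntegral_eq_of_sigmaFinite
    (Measurable.lintegral_prod_right' (hg.enorm.pow_const c))
    (Measurable.lintegral_prod_right' (hh.enorm.pow_const c)) fun A _ _ => ?_
  rw [key hg hYg, key hh hZh]
  exact (hYZ.comp (measurable_setLIntegral_enorm_rpow_Lp A c)).lintegral_eq

end SectionMaps

/-! ### The Monte Carlo error bound and convergence. -/

section MonteCarlo

variable {S : Type u} {Ω : Type v} [MeasurableSpace S] [MeasurableSpace Ω]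
  {μ : Measure S} [SigmaFinite μ] {P : Measure Ω} [IsProbabilityMeasure P]
  {p q : ℝ≥0∞} [hp1 : Fact (1 ≤ p)] [hq1 : Fact (1 ≤ q)]
  [MeasurableSpace (Lp ℝ p μ)] [BorelSpace (Lp ℝ p μ)]

theorem eLpNorm_sum_centered_le (hp : p ≠ ∞) (hq : q ≠ ∞) {M : ℕ} [NeZero M]
    {X : Fin M → Ω → Lp ℝ p μ} (hX : ∀ j, MemLp (X j) q P) (hmix : ∀ j, MemMixed q μ P (X j))
    (hind : iIndepFun X P) (hid : ∀ j, IdentDistrib (X j) (X 0) P P) :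
    eLpNorm (fun ω => ∑ j, (X j ω - ∫ ω', X 0 ω' ∂P)) q P ≤
      ENNReal.ofReal ((M : ℝ) ^ (1 / (min q 2).toReal) * constSL q μ P (X 0)) := by
  obtain ⟨R, _, Q, _, _, r, hr⟩ := exists_isRademacherFamily
  have hq0 : q ≠ 0 := (zero_lt_one.trans_le hq1.out).ne'
  have hq' : 0 < q.toReal := ENNReal.toReal_pos hq0 hq
  obtain ⟨ht0, -, -⟩ := min_two_toReal_bounds hq1.out hq
  set t := (min q 2).toReal
  set c : Lp ℝ p μ := ∫ ω', X 0 ω' ∂P with hc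
  have hsub : Measurable fun f : Lp ℝ p μ => f - c := (continuous_id.sub continuous_const).measurable
  have hY : ∀ j, MemLp (fun ω => X j ω - c) q P := fun j => (hX j).sub (memLp_const c)
  have h0 : ∀ j, ∫ ω, (X j ω - c) ∂P = 0 := fun j => by
    rw [integral_sub ((hX j).integrable hq1.out) (integrable_const c), (hid j).integral_eq]
    simp [hc]
  have hYind : iIndepFun (fun j ω => X j ω - c) P := hind.comp (fun _ f => f - c) fun _ => hsub
  have hYid : ∀ j, IdentDistrib (fun ω => X j ω - c) (fun ω => X 0 ω - c) P P :=
    fun j => (hid j).comp hsub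
  have hMt : ENNReal.ofReal ((M : ℝ) ^ (1 / t)) = (M : ℝ≥0∞) ^ (1 / t) := by
    rw [← ENNReal.ofReal_rpow_of_nonneg (by positivity) (by positivity), ENNReal.ofReal_natCast]
  rw [ENNReal.ofReal_mul (by positivity), hMt, constSL]
  split_ifs with hqp
  · refine (hr.eLpNorm_sum_le_of_lt hp hqp hY h0 hYind fun j => (hYid j).eLpNorm_eq q).trans_eq ?_
    rw [ENNReal.ofReal_mul (mul_nonneg (mul_nonneg zero_le_two (kahaneKhintchineK_nonneg _ _))
        (khintchineB_nonneg _)),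
      ENNReal.ofReal_mul (mul_nonneg zero_le_two (kahaneKhintchineK_nonneg _ _)),
      ENNReal.ofReal_mul zero_le_two, ENNReal.ofReal_toReal (hY 0).eLpNorm_ne_top,
      ENNReal.ofReal_ofNat]
    ring
  · have hmixY := (hmix 0).sub_const c
    rw [ENNReal.ofReal_mul (mul_nonneg zero_le_two (khintchineB_nonneg _)),
      ENNReal.ofReal_mul zero_le_two, ENNReal.ofReal_toReal hmixY.eMixedNorm_ne_top,
      ENNReal.ofReal_ofNat, ← mul_assoc]
    set C := (M : ℝ≥0∞) ^ (1 / t) * (2 * ENNReal.ofReal (khintchineB q))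
    have hC : C ≠ ∞ := ENNReal.mul_ne_top (ENNReal.rpow_ne_top_of_nonneg (by positivity)
      (ENNReal.natCast_ne_top M)) (ENNReal.mul_ne_top ENNReal.ofNat_ne_top ENNReal.ofReal_ne_top)
    -- The mixed norm is an infimum; with `C` on the other side, the bound can be proved separately
    -- for each section map `F`.
    rw [mul_comm C, ← ENNReal.div_le_iff_le_mul (Or.inr hmixY.eMixedNorm_ne_top) (Or.inl hC)]
    refine le_iInf₂ fun F hF => ENNReal.div_le_of_le_mul ?_
    obtain ⟨-, g, hg, hYg, hFg⟩ := hF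
    choose G hG using hmix
    choose hGS hGp using hG
    choose k hk hXk hGk using fun j => (hGS j).2
    have hN : ∀ j, ∀ᵐ s ∂μ, (∫⁻ ω, ‖k j (s, ω) - c s‖ₑ ^ q.toReal ∂P) ^ (1 / q.toReal) =
        ‖F s‖ₑ := by
      intro j
      have h := ae_lintegral_section_eq_of_identDistrib (hYid j)
        (g := fun z => k j z - c z.1)
        ((hk j).sub ((Lp.stronglyMeasurable c).measurable.comp measurable_fst)) hg
        (ae_coeFn_sub_eq (hXk j) c) hYg q.toReal
      filter_upwards [h, hFg] with s h1 h2
      rw [h1, Lp.enorm_def, eLpNorm_congr_ae h2, eLpNorm_eq_lintegral_rpow_enorm_toReal hq0 hq]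
    refine (hr.eLpNorm_sum_le_of_le hq (not_lt.1 hqp) hY h0 hYind
      (g := fun j z => k j z - c z.1)
      (fun j => (hk j).sub ((Lp.stronglyMeasurable c).measurable.comp measurable_fst))
      (fun j => ae_coeFn_sub_eq (hXk j) c) hN).trans_eq ?_
    rw [eLpNorm_eq_lintegral_rpow_enorm_toReal (zero_lt_one.trans_le hp1.out).ne' hp]
    ring

/-- The error bound for the Monte Carlo method in `L^p(S)`. -/
theorem eLpNorm_sub_average_le (hp : p ≠ ∞) (hq : q ≠ ∞) {M : ℕ} [NeZero M]
    {X : Fin M → Ω → Lp ℝ p μ} (hX : ∀ j, MemLp (X j) q P) (hmix : ∀ j, MemMixed q μ P (X j))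
    (hind : iIndepFun X P) (hid : ∀ j, IdentDistrib (X j) (X 0) P P) (U : Lp ℝ p μ) :
    eLpNorm (fun ω => U - (M : ℝ)⁻¹ • ∑ j, X j ω) q P ≤
      ENNReal.ofReal (‖U - ∫ ω, X 0 ω ∂P‖ +
        (M : ℝ) ^ (-(1 - 1 / (min q 2).toReal)) * constSL q μ P (X 0)) := by
  have hsum := eLpNorm_sum_centered_le hp hq hX hmix hind hid
  have hq0 : q ≠ 0 := (zero_lt_one.trans_le hq1.out).ne'
  have hM : (0 : ℝ) < M := by exact_mod_cast NeZero.pos M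
  set t := (min q 2).toReal
  set c : Lp ℝ p μ := ∫ ω', X 0 ω' ∂P
  have hC := constSL_nonneg (q := q) (P := P) (X 0)
  have e : (fun ω => U - (M : ℝ)⁻¹ • ∑ j, X j ω) =
      (fun _ => U - c) - (M : ℝ)⁻¹ • fun ω => ∑ j, (X j ω - c) := by
    funext ω
    simp only [Pi.sub_apply, Pi.smul_apply, Finset.sum_sub_distrib, Finset.sum_const,
      Finset.card_univ, Fintype.card_fin, smul_sub]
    rw [← Nat.cast_smul_eq_nsmul ℝ M c, smul_smul, inv_mul_cancel₀ hM.ne', one_smul]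
    abel
  have hm : AEStronglyMeasurable (fun ω => ∑ j, (X j ω - c)) P :=
    Finset.aestronglyMeasurable_fun_sum _ fun j _ => (hX j).1.sub aestronglyMeasurable_const
  rw [e, ENNReal.ofReal_add (norm_nonneg _) (by positivity)]
  refine (eLpNorm_sub_le aestronglyMeasurable_const (hm.const_smul _) hq1.out).trans ?_
  refine add_le_add ?_ ?_
  · rw [eLpNorm_const _ hq0 (IsProbabilityMeasure.ne_zero P)]
    simp
  · rw [eLpNorm_const_smul, Real.enorm_eq_ofReal (by positivity)]
    refine (mul_le_mul' le_rfl hsum).trans_eq ?_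
    rw [← ENNReal.ofReal_mul (by positivity), ← mul_assoc]
    congr 2
    rw [← Real.rpow_neg_one, ← Real.rpow_add hM]
    congr 1
    ring

end MonteCarlo


theorem mainTheorem2 {S : Type u} {Ω : Type v} [MeasurableSpace S] [MeasurableSpace Ω]
    (μ : Measure S) [SigmaFinite μ] (P : Measure Ω) [IsProbabilityMeasure P]
    (hS : ApproximationByAveraging.{u, v} μ) :
    -- the error bound
    (∀ (p q : ℝ≥0∞) [Fact (1 ≤ p)] [Fact (1 ≤ q)], p ≠ ∞ → q ≠ ∞ →
      ∀ [MeasurableSpace (Lp ℝ p μ)] [BorelSpace (Lp ℝ p μ)]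
        (M : ℕ) [NeZero M] (X : Fin M → Ω → Lp ℝ p μ),
        (∀ j, MemLp (X j) q P) → (∀ j, MemMixed q μ P (X j)) →
        iIndepFun X P → (∀ j, IdentDistrib (X j) (X 0) P P) →
        ∀ U : Lp ℝ p μ,
          eLpNorm (fun ω => U - (M : ℝ)⁻¹ • ∑ j, X j ω) q P ≤
            ENNReal.ofReal (‖U - ∫ ω, X 0 ω ∂P‖ +
              (M : ℝ) ^ (-(1 - 1 / (min q 2).toReal)) * constSL q μ P (X 0))) ∧
    -- convergence of the Monte Carlo method for random variables with values in `L^1(S)`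
    (∀ (q : ℝ≥0∞) [Fact (1 ≤ q)], 1 < q → q ≠ ∞ →
      ∀ [MeasurableSpace (Lp ℝ 1 μ)] [BorelSpace (Lp ℝ 1 μ)] (X : ℕ → Ω → Lp ℝ 1 μ),
        (∀ j, MemLp (X j) q P) → (∀ j, MemMixed q μ P (X j)) →
        iIndepFun X P → (∀ j, IdentDistrib (X j) (X 0) P P) →
        Tendsto (fun M : ℕ => eLpNorm
            (fun ω => (∫ ω', X 0 ω' ∂P) - (M : ℝ)⁻¹ • ∑ j ∈ Finset.range M, X j ω) q P)
          atTop (𝓝 0)) := by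

  refine ⟨fun p q _ _ hp hq _ _ M _ X hX hmix hind hid U =>
    eLpNorm_sub_average_le hp hq hX hmix hind hid U, ?_⟩
  intro q _ hq1 hq _ _ X hX hmix hind hid
  have hbound : ∀ᶠ M : ℕ in atTop, eLpNorm
      (fun ω => (∫ ω', X 0 ω' ∂P) - (M : ℝ)⁻¹ • ∑ j ∈ Finset.range M, X j ω) q P ≤
        ENNReal.ofReal ((M : ℝ) ^ (-(1 - 1 / (min q 2).toReal)) * constSL q μ P (X 0)) := by
    filter_upwards [eventually_gt_atTop 0] with M hM
    have : NeZero M := ⟨hM.ne'⟩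
    -- Choosing `U = 𝔼 X` removes the bias term.
    have h := eLpNorm_sub_average_le (p := 1) ENNReal.one_ne_top hq (M := M)
      (X := fun j => X j) (fun j => hX j) (fun j => hmix j) (hind.precomp Fin.val_injective)
      (fun j => by simpa using hid j) (∫ ω', X 0 ω' ∂P)
    simpa only [Fin.coe_ofNat_eq_mod, Nat.zero_mod, sub_self, norm_zero, zero_add,
      ← Fin.sum_univ_eq_sum_range (fun j => X j _)] using h
  refine tendsto_of_tendsto_of_tendsto_of_le_of_le' tendsto_const_nhds ?_
    (Eventually.of_forall fun _ => zero_le) hbound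
  -- `q > 1` makes the power of `M` strictly negative.
  have ht : 1 < (min q 2).toReal := by
    have h1 : (1 : ℝ≥0∞) < min q 2 := lt_min hq1 ENNReal.one_lt_two
    have h2 : min q 2 ≠ ∞ := ne_top_of_le_ne_top hq (min_le_left _ _)
    simpa using (ENNReal.toReal_lt_toReal ENNReal.one_ne_top h2).2 h1
  have hpos : 0 < 1 - 1 / (min q 2).toReal := by
    rw [sub_pos, div_lt_one (by linarith)]
    exact ht
  have hlim := ((tendsto_rpow_neg_atTop hpos).comp tendsto_natCast_atTop_atTop).mul_const
    (constSL q μ P (X 0))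
  simpa using ENNReal.tendsto_ofReal hlim
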